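/- Let $\mathbb{C}\{t,z\}$ be the ring of convergent power series in $t=(t_1,t_2)$ and $z$, and let $\mathbb{C}\{t,z]]$ be the ring of series $\sum_{k\ge 0}a_k(t)z^k$ whose coefficients $a_k$ are all holomorphic on one common neighbourhood of $0\in\mathbb{C}^2$; $\mathbb{C}\{t_2,z\}$ and $\mathbb{C}\{t_2,z]]$ are the subrings of elements independent of $t_1$. Write $f=\sum_k f(k)z^k$, and $\partial_i=\partial/\partial t_i$. A holomorphic (resp. formal) $(T)$-structure of rank $2$ over the germ $(\mathbb{C}^2,0)$ is a connection form $z^{-1}(A_1dt_1+A_2dt_2)$ with $A_1,A_2\in M_2(\mathbb{C}\{t,z\})$ (resp. $M_2(\mathbb{C}\{t,z]])$) such that $z\partial_1A_2-z\partial_2A_1+[A_1,A_2]=0$. It is a $(T)$-structure over $\mathcal N_2$ if there is a holomorphic vector $\zeta(t)\in\mathbb{C}\{t\}^2$ such that $A_1(0)\zeta$, $A_2(0)\zeta$ form a basis at $t=0$ (unfolding condition) and the induced multiplication on vector fields, defined by $C_{X\circ Y}\zeta=C_XC_Y\zeta$ with $C_{\partial_i}=A_i(0)$ (the coefficient of $z^0$),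 is that of the germ of $F$-manifold $\mathcal N_2$: $\partial_1$ is the unit field and $\partial_2\circ\partial_2=0$. Two such structures $(A_1,A_2)$ and $(\tilde A_1,\tilde A_2)$ are holomorphically (resp. formally) gauge isomorphic if there is a matrix $T\in M_2(\mathbb{C}\{t,z\})$ (resp. $M_2(\mathbb{C}\{t,z]])$), invertible at the origin, with $z\partial_iT+A_iT-T\tilde A_i=0$ for $i=1,2$. Put $C_1=\begin{pmatrix}1&0\\0&1\end{pmatrix}$, $C_2=\begin{pmatrix}0&0\\1&0\end{pmatrix}$, $E=\begin{pmatrix}0&1\\0&0\end{pmatrix}$, and consider the form $$A_1=C_1,\qquad A_2=C_2+zfE.\qquad(*)$$ **Theorem.** (i) Every holomorphic $(T)$-structure over $\mathcal N_2$ is holomorphically gauge isomorphic to a $(T)$-structure over $\mathcal N_2$ of the form $(*)$ with $f\in\mathbb{C}\{t_2,z\}$. (ii) Every formal $(T)$-structure over $\mathcal N_2$ is formally gauge isomorphic to a formal $(T)$-structure over $\mathcal N_2$ of the form $(*)$ with $f\in\mathbb{C}\{t_2,z]]$. (iii) For a holomorphic or formal $(T)$-structure of the form $(*)$, with $f\in\mathbb{C}\{t_2,z\}$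 respectively $f\in\mathbb{C}\{t_2,z]]$, the function $f(0)$ is a formal gauge invariant: if the structures $(*)$ with functions $f$ and $g$ are formally gauge isomorphic, then $f(0)=g(0)$. If moreover $f(0)=0$, then also $f(1)$ is a formal gauge invariant, that is, $f(1)=g(1)$. (iv) A holomorphic $(T)$-structure of the form $(*)$ with $f\in\mathbb{C}\{t_2,z\}$ and $f(0)=0$ is holomorphically gauge isomorphic to $A_1=C_1$, $A_2=C_2+z^2f(1)E$, and this is the only structure of the form $A_1=C_1$, $A_2=C_2+z^2gE$ with $g\in\mathbb{C}\{t_2\}$ to which it is holomorphically gauge isomorphic. (v) Consider a holomorphic or formal $(T)$-structure of the form $(*)$ with $f(0)\ne0$ and $r=\mathrm{ord}_0f(0)\in\mathbb{Z}_{\ge0}$. If $r\in\{0,1\}$, it is formally gauge isomorphic to $A_1=C_1$, $A_2=C_2+zf(0)E$. If $r\ge2$, it is formally gauge isomorphic to some $A_1=C_1$, $A_2=C_2+z\tilde fE$ with $\tilde f\in\mathbb{C}\{t_2,z]]$, $\tilde f(0)=f(0)$ and $\tilde f(k)\in\mathbb{C}[t_2]_{\le r-2}$ (polynomials of degree at most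 $r-2$) for all $k\ge1$. Call $F\in\mathbb{C}\{t_2,z]]$ a normal form if $F(0)\neq 0$ and, with $s=\mathrm{ord}_0F(0)$, either $s\le1$ and $F=F(0)$, or $s\ge2$ and $F(k)\in\mathbb{C}[t_2]_{\le s-2}$ for all $k\ge1$. The normal form to which a given structure $(*)$ is formally gauge isomorphic is unique, and it is a formal gauge invariant: formally gauge isomorphic structures have the same normal form. -/

import Mathlib

namespace TStr

/-! ### Rings of power series in `t₁, t₂, z` -/

/-- `ℂ⟦t₂⟧`. -/
abbrev SerT2 : Type := PowerSeries ℂ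

/-- `ℂ⟦t₁, t₂⟧`, realised as `ℂ⟦t₂⟧⟦t₁⟧`. -/
abbrev SerT : Type := PowerSeries SerT2

/-- `ℂ⟦t₁, t₂, z⟧`, realised as `ℂ⟦t₁, t₂⟧⟦z⟧`; the coefficient of `z ^ k` of `f` is
`PowerSeries.coeff k f`, an element of `ℂ⟦t₁, t₂⟧`. -/
abbrev Ser : Type := PowerSeries SerT

/-- `ℂ⟦t₂, z⟧`, realised as `ℂ⟦t₂⟧⟦z⟧`. -/
abbrev SerT2Z : Type := PowerSeries SerT2

/-- The coefficient of `z ^ k * t₁ ^ i * t₂ ^ j`. -/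
noncomputable def cf (f : Ser) (k i j : ℕ) : ℂ :=
  PowerSeries.coeff j (PowerSeries.coeff i (PowerSeries.coeff k f))

/-- `ℂ{t, z}`: the power series in `(t₁, t₂, z)` which converge (absolutely) on some closed
polydisc of positive radius, i.e. the Taylor series of the germs at `0` of holomorphic functions
of `(t₁, t₂, z)`. -/
def holomorphicSeries : Set Ser :=
  {f | ∃ ρ : ℝ, 0 < ρ ∧
    Summable fun p : ℕ × ℕ × ℕ => ‖cf f p.1 p.2.1 p.2.2‖ * ρ ^ (p.1 + p.2.1 + p.2.2)}

/-- `ℂ{t, z]]`: the series `∑ a_k(t) z ^ k` such that all the `a_k` are holomorphic on one and the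
same neighbourhood of `0`, i.e. their Taylor series all converge (absolutely) on a common closed
polydisc of positive radius. There is no condition on the growth in `k`. -/
def formalSeries : Set Ser :=
  {f | ∃ ρ : ℝ, 0 < ρ ∧
    ∀ k : ℕ, Summable fun p : ℕ × ℕ => ‖cf f k p.1 p.2‖ * ρ ^ (p.1 + p.2)}

/-- Holomorphic data are a special case of formal data. -/
theorem holomorphicSeries_subset_formalSeries : holomorphicSeries ⊆ formalSeries := by
  rintro f ⟨ρ, hρ, h⟩
  refine ⟨ρ, hρ, fun k => ?_⟩
  have h1 := h.comp_injective (i := fun p : ℕ × ℕ => (k, p))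
    (fun a b hab => (Prod.mk.inj hab).2)
  have h2 := h1.mul_left ((ρ ^ k)⁻¹)
  refine h2.congr fun p => ?_
  have : ρ ^ k ≠ 0 := (pow_pos hρ k).ne'
  simp only [Function.comp]
  rw [add_assoc, pow_add]
  field_simp

/-- The inclusion `ℂ⟦t₂, z⟧ ⊆ ℂ⟦t₁, t₂, z⟧` as the series which do not involve `t₁`. -/
noncomputable def incl : SerT2Z →+* Ser := PowerSeries.map PowerSeries.C

/-- The coordinate `z`. -/
noncomputable def z : Ser := PowerSeries.X

/-- `∂ / ∂t₁` (index `0`) and `∂ / ∂t₂` (index `1`), acting coefficientwise in `z`. -/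
noncomputable def pd (i : Fin 2) (f : Ser) : Ser :=
  PowerSeries.mk fun k =>
    if i = 0 then PowerSeries.derivative SerT2 (PowerSeries.coeff k f)
    else PowerSeries.mk fun l =>
      PowerSeries.derivative ℂ (PowerSeries.coeff l (PowerSeries.coeff k f))

/-! ### (T)-structures over the germ `(ℂ², 0)` and gauge isomorphisms -/

/-- `2 × 2` matrices over `ℂ⟦t₁, t₂, z⟧`. -/
abbrev Mat : Type := Matrix (Fin 2) (Fin 2) Ser

/-- The entrywise partial derivative of a matrix. -/
noncomputable def mpd (i : Fin 2) (M : Mat) : Mat := M.map (pd i)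

/-- `A = (A₁, A₂) = (A 0, A 1)` defines the (T)-structure with connection form
`z⁻¹ (A₁ dt₁ + A₂ dt₂)` on the trivial bundle of rank two over the germ `(ℂ², 0)`: the entries lie
in the ring `𝒪` (`holomorphicSeries` for holomorphic (T)-structures, `formalSeries` for formal
ones), and the connection is flat. -/
structure IsTStructure (𝒪 : Set Ser) (A : Fin 2 → Mat) : Prop where
  entries : ∀ i a b, A i a b ∈ 𝒪
  flat : ∀ i j, z • mpd i (A j) - z • mpd j (A i) + (A i * A j - A j * A i) = 0

/-- The matrix of the Higgs field `C_{∂ᵢ}` on the restriction of the bundle to `z = 0`. -/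
noncomputable def higgs (A : Fin 2 → Mat) (i : Fin 2) : Matrix (Fin 2) (Fin 2) SerT :=
  (A i).map (PowerSeries.coeff 0)

/-- The multiplication of the germ of F-manifold `𝒩₂`: `∂ᵢ ∘ ∂ⱼ = ∑ₖ (n2mul i j k) ∂ₖ`, where
`∂₁` (index `0`) is the unit field and `∂₂ ∘ ∂₂ = 0`. -/
noncomputable def n2mul (i j : Fin 2) : Fin 2 → SerT :=
  if i = 0 then Pi.single j 1 else if j = 0 then Pi.single i 1 else 0

/-- The connection satisfies the unfolding condition and induces the F-manifold `𝒩₂`: there is a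
holomorphic primitive section `ζ`, i.e. `X ↦ C_X ζ` is an isomorphism (the vectors `C_{∂₁} ζ` and
`C_{∂₂} ζ` form a frame), and the multiplication given by `C_{X ∘ Y} ζ = C_X C_Y ζ` is
that of `𝒩₂`. A square matrix over `ℂ⟦t₁, t₂⟧` is a unit if and only if its value at
`t = 0` is invertible. -/
def InducesN2 (A : Fin 2 → Mat) : Prop :=
  ∃ ζ : Fin 2 → SerT,
    (∀ a, PowerSeries.C (ζ a) ∈ holomorphicSeries) ∧
    IsUnit (Matrix.of fun a i => (higgs A i).mulVec ζ a) ∧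
    ∀ i j, ∑ k, n2mul i j k • (higgs A k).mulVec ζ =
      (higgs A i).mulVec ((higgs A j).mulVec ζ)

/-- (T)-structures over `𝒩₂`, with entries in `𝒪`. -/
def IsTStructureN2 (𝒪 : Set Ser) (A : Fin 2 → Mat) : Prop :=
  IsTStructure 𝒪 A ∧ InducesN2 A

/-- `A` and `A'` are gauge isomorphic by a matrix `T` with entries in `𝒪`: holomorphically gauge
isomorphic for `𝒪 = holomorphicSeries`, formally gauge isomorphic for `𝒪 = formalSeries`.
Here `T` is a unit over `ℂ⟦t₁, t₂, z⟧` if and only if its value at the origin is invertible, and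
then the entries of its inverse lie in the respective ring as well. -/
def GaugeIso (𝒪 : Set Ser) (A A' : Fin 2 → Mat) : Prop :=
  ∃ T : Mat, (∀ a b, T a b ∈ 𝒪) ∧ IsUnit T ∧
    ∀ i, z • mpd i T + A i * T - T * A' i = 0

/-! ### Normal forms -/

/-- The matrix `C₁ = Id`. -/
noncomputable def C₁ : Mat := 1

/-- The matrix `C₂`. -/
noncomputable def C₂ : Mat := !![0, 0; 1, 0]

/-- The matrix `E`. -/
noncomputable def E : Mat := !![0, 1; 0, 0]

/-- The pair `A₁ = C₁`, `A₂ = C₂ + z f E` for a series `f` in `(t₂, z)`. -/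
noncomputable def form (f : SerT2Z) : Fin 2 → Mat :=
  ![C₁, C₂ + (z * incl f) • E]

/-- `F ∈ ℂ{t₂, z]]` is a normal form with `ord₀ F(0) = r`: it is `F(0)` if `r ≤ 1`, and all `F(k)`,
`k ≥ 1`, are polynomials of degree at most `r - 2` if `r ≥ 2`. -/
structure IsFormalNormalForm (r : ℕ) (F : SerT2Z) : Prop where
  mem : incl F ∈ formalSeries
  order_eq : (PowerSeries.coeff 0 F).order = r
  low : r ≤ 1 → F = PowerSeries.C (PowerSeries.coeff 0 F)
  high : 2 ≤ r → ∀ k, 1 ≤ k →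
    ∃ p : Polynomial ℂ, p.natDegree ≤ r - 2 ∧ PowerSeries.coeff k F = (p : PowerSeries ℂ)

end TStr

/-!
# Normal forms of (T)-structures over the F-manifold `𝒩₂`

**Convergence.** Both `ℂ{t, z}` and `ℂ{t, z]]` consist of the series which have finite weighted
`ℓ¹` norm `∑ |a_{kij}| w k ρ ^ (i + j)` for some radius `ρ` and some submultiplicative weight `w`:
a geometric weight in the first case, an arbitrary one in the second, since weights may decay
arbitrarily fast (`holomorphicSeries_eq`, `formalSeries_eq`). For a fixed weight the norm is
submultiplicative and integration has norm at most `ρ`, so that a contraction argument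
(`exists_fixed_point`) gives inverses and solutions of linear differential equations in both rings
at once (`IsWeightClass.mem_of_mul_eq_one`, `IsWeightClass.exists_ode`).

**Reduction to the form `C₂ + z f E`.** The Higgs field of the unit field is the identity, so
`A₁ = 1 + z B`, and the gauge transformation solving `∂₁ T = -B T` makes `A₁ = 1`. By flatness `A₂`
then does not involve `t₁`. The Higgs field of `∂₂` is nilpotent and non-zero, hence some constant
vector `u` is cyclic for the operator `z ∂₂ + A₂`; rescaling `u` by the solution of a scalar ODE
removes the first order term of the second order equation satisfied by `u`, and the frame `u`,
`(z ∂₂ + A₂) u` puts `A₂` into the required form (`IsWeightClass.exists_form_of_nilpotent`).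

**Gauge equations.** A gauge transformation from `form f` to `form g` is determined by its first
column `(a, b)`, and exists if and only if `g = f + z h` with
`2 a' = z (h b - b'')` and `h a = a'' + f' b + 2 f b'` for some `a`, `b` with `a` a unit
(`exists_quotient_of_gaugeIso`, `IsWeightClass.gaugeIso_form`). Lowest order terms give the
invariants `f(0)` and, if `f(0) = 0`, `f(1)`. If `f(0) = 0`, the equations for the target
`z f(1)` can be divided by `z` once more and become a linear system, which has a holomorphic
solution (`IsWeightClass.gaugeIso_of_coeff_zero_eq_zero`).

**Formal normal forms.** If `f(0)` has order `r`, the operator `b ↦ 2 f(0) b' + f(0)' b` is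
surjective for `r ≤ 1`; for `r ≥ 2` it is injective and its image is complementary to the
polynomials of degree at most `r - 2` (`exists_solver`, `eq_zero_of_solution`). The gauge equations
are then solved order by order in `z`, with all coefficients converging on one disc because the
convergent series on an open disc are stable under differentiation (`exists_isFormalNormalForm`);
the same induction proves uniqueness (`IsFormalNormalForm.eq_of_gaugeIso`).
-/

open PowerSeries
open scoped ENNReal

namespace TStr

/-! ### Weighted `ℓ¹` norms on power series -/

/-- A submultiplicative extended seminorm on a semiring. -/
structure IsSubmulNorm {R : Type*} [Semiring R] (n : R → ℝ≥0∞) : Prop where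
  map_zero : n 0 = 0
  add_le : ∀ a b, n (a + b) ≤ n a + n b
  mul_le : ∀ a b, n (a * b) ≤ n a * n b

theorem IsSubmulNorm.sum_le {R ι : Type*} [Semiring R] {n : R → ℝ≥0∞} (hn : IsSubmulNorm n)
    (s : Finset ι) (f : ι → R) : n (∑ i ∈ s, f i) ≤ ∑ i ∈ s, n (f i) := by
  classical
  induction s using Finset.induction_on with
  | empty => simp [hn.map_zero]
  | insert a s ha ih =>
    rw [Finset.sum_insert ha, Finset.sum_insert ha]
    exact (hn.add_le _ _).trans (by gcongr)

/-- The weighted `ℓ¹` norm `∑ n(fₖ) wₖ` of a power series `∑ fₖ Xᵏ`. -/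
noncomputable def wnorm {R : Type*} [Semiring R] (n : R → ℝ≥0∞) (w : ℕ → ℝ≥0∞)
    (f : PowerSeries R) : ℝ≥0∞ := ∑' k, n (coeff k f) * w k

theorem tsum_mul_tsum_antidiagonal (a b : ℕ → ℝ≥0∞) :
    (∑' k, a k) * (∑' k, b k) =
      ∑' k, ∑ p ∈ Finset.HasAntidiagonal.antidiagonal k, a p.1 * b p.2 := by
  have h1 : (∑' k, a k) * (∑' k, b k) = ∑' p : ℕ × ℕ, a p.1 * b p.2 := by
    rw [ENNReal.tsum_prod (f := fun i j => a i * b j)]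
    simp_rw [ENNReal.tsum_mul_left, ENNReal.tsum_mul_right]
  rw [h1, ← Finset.HasAntidiagonal.sigmaAntidiagonalEquivProd.tsum_eq, ENNReal.tsum_sigma']
  refine tsum_congr fun k => ?_
  rw [← Finset.sum_coe_sort]
  exact tsum_fintype _

theorem IsSubmulNorm.wnorm {R : Type*} [Semiring R] {n : R → ℝ≥0∞} (hn : IsSubmulNorm n)
    {w : ℕ → ℝ≥0∞} (hw : ∀ j k, w (j + k) ≤ w j * w k) : IsSubmulNorm (wnorm n w) where
  map_zero := by simp [TStr.wnorm, hn.map_zero]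
  add_le a b := by
    rw [TStr.wnorm, TStr.wnorm, TStr.wnorm, ← ENNReal.tsum_add]
    refine ENNReal.tsum_le_tsum fun k => ?_
    rw [← add_mul, map_add]
    gcongr
    exact hn.add_le _ _
  mul_le a b := by
    rw [TStr.wnorm, TStr.wnorm, TStr.wnorm, tsum_mul_tsum_antidiagonal]
    refine ENNReal.tsum_le_tsum fun k => ?_
    rw [coeff_mul]
    refine (mul_le_mul_left (hn.sum_le _ _) _).trans ?_
    rw [Finset.sum_mul]
    refine Finset.sum_le_sum fun p hp => ?_
    rw [← Finset.HasAntidiagonal.mem_antidiagonal.1 hp]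
    calc n (coeff p.1 a * coeff p.2 b) * w (p.1 + p.2)
        ≤ (n (coeff p.1 a) * n (coeff p.2 b)) * (w p.1 * w p.2) :=
          mul_le_mul' (hn.mul_le _ _) (hw _ _)
      _ = _ := by ring

theorem isSubmulNorm_enorm : IsSubmulNorm (fun x : ℂ => ‖x‖ₑ) where
  map_zero := by simp
  add_le a b := enorm_add_le a b
  mul_le a b := by simp [enorm_mul]

theorem pow_submul (ρ : ℝ≥0∞) (j k : ℕ) : ρ ^ (j + k) ≤ ρ ^ j * ρ ^ k := (pow_add _ _ _).le

/-- The norm `∑ |a_{kij}| w k ρ ^ i ρ ^ j` of `∑ a_{kij} z ^ k t₁ ^ i t₂ ^ j`. -/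
noncomputable def nrm (w : ℕ → ℝ≥0∞) (ρ : ℝ≥0∞) : Ser → ℝ≥0∞ :=
  wnorm (wnorm (wnorm (fun x : ℂ => ‖x‖ₑ) (ρ ^ ·)) (ρ ^ ·)) w

/-- The weight of the monomial `z ^ k t₁ ^ i t₂ ^ j`. -/
noncomputable def wt (w : ℕ → ℝ≥0∞) (ρ : ℝ≥0∞) (p : ℕ × ℕ × ℕ) : ℝ≥0∞ :=
  w p.1 * ρ ^ p.2.1 * ρ ^ p.2.2

/-- The coefficient `cf` as a function of a triple of exponents. -/
noncomputable def cft (f : Ser) (p : ℕ × ℕ × ℕ) : ℂ := cf f p.1 p.2.1 p.2.2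

theorem nrm_eq_tsum (w : ℕ → ℝ≥0∞) (ρ : ℝ≥0∞) (f : Ser) :
    nrm w ρ f = ∑' p : ℕ × ℕ × ℕ, ‖cft f p‖ₑ * wt w ρ p := by
  rw [ENNReal.tsum_prod']
  refine tsum_congr fun k => ?_
  rw [wnorm, ← ENNReal.tsum_mul_right, ENNReal.tsum_prod']
  refine tsum_congr fun i => ?_
  rw [wnorm, ← ENNReal.tsum_mul_right, ← ENNReal.tsum_mul_right]
  refine tsum_congr fun j => ?_
  simp only [wt, cft, cf]
  ring

theorem isSubmulNorm_nrm {w : ℕ → ℝ≥0∞} (hw : ∀ j k, w (j + k) ≤ w j * w k) (ρ : ℝ≥0∞) :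
    IsSubmulNorm (nrm w ρ) :=
  ((isSubmulNorm_enorm.wnorm (pow_submul ρ)).wnorm (pow_submul ρ)).wnorm hw

@[ext] theorem ser_ext {f g : Ser} (h : ∀ p, cft f p = cft g p) : f = g :=
  PowerSeries.ext fun k => PowerSeries.ext fun i => PowerSeries.ext fun j => h (k, i, j)

@[simp] theorem cft_add (f g : Ser) (p) : cft (f + g) p = cft f p + cft g p := by simp [cft, cf]
@[simp] theorem cft_sub (f g : Ser) (p) : cft (f - g) p = cft f p - cft g p := by simp [cft, cf]
@[simp] theorem cft_neg (f : Ser) (p) : cft (-f) p = -cft f p := by simp [cft, cf]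
@[simp] theorem cft_zero (p) : cft 0 p = 0 := by simp [cft, cf]
theorem cft_sum {ι : Type*} (s : Finset ι) (f : ι → Ser) (p) :
    cft (∑ i ∈ s, f i) p = ∑ i ∈ s, cft (f i) p := by simp [cft, cf, map_sum]

theorem cft_mul (f g : Ser) (p : ℕ × ℕ × ℕ) :
    cft (f * g) p = ∑ a ∈ Finset.HasAntidiagonal.antidiagonal p.1,
      ∑ b ∈ Finset.HasAntidiagonal.antidiagonal p.2.1,
      ∑ c ∈ Finset.HasAntidiagonal.antidiagonal p.2.2,
        cft f (a.1, b.1, c.1) * cft g (a.2, b.2, c.2) := by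
  simp [cft, cf, coeff_mul, map_sum]

/-- The series with prescribed coefficients. -/
noncomputable def ofCoeffs (c : ℕ × ℕ × ℕ → ℂ) : Ser :=
  PowerSeries.mk fun k => PowerSeries.mk fun i => PowerSeries.mk fun j => c (k, i, j)

@[simp] theorem cft_ofCoeffs (c : ℕ × ℕ × ℕ → ℂ) (p) : cft (ofCoeffs c) p = c p := by
  simp [cft, cf, ofCoeffs]

theorem nrm_le_of_injective {w w' : ℕ → ℝ≥0∞} {ρ ρ' C : ℝ≥0∞} {f g : Ser}
    {φ : ℕ × ℕ × ℕ → ℕ × ℕ × ℕ} (hφ : Function.Injective φ)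
    (h : ∀ p, ‖cft g p‖ₑ * wt w' ρ' p ≤ C * (‖cft f (φ p)‖ₑ * wt w ρ (φ p))) :
    nrm w' ρ' g ≤ C * nrm w ρ f := by
  rw [nrm_eq_tsum, nrm_eq_tsum]
  refine (ENNReal.tsum_le_tsum h).trans ?_
  rw [ENNReal.tsum_mul_left]
  refine mul_le_mul_right ?_ C
  exact ENNReal.tsum_comp_le_tsum_of_injective hφ (fun p => ‖cft f p‖ₑ * wt w ρ p)

theorem nrm_le_of_support {w w' : ℕ → ℝ≥0∞} {ρ ρ' C : ℝ≥0∞} {f g : Ser}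
    {ψ : ℕ × ℕ × ℕ → ℕ × ℕ × ℕ} (hψ : Function.Injective ψ)
    (h0 : ∀ p, p ∉ Set.range ψ → cft g p = 0)
    (h : ∀ p, ‖cft g (ψ p)‖ₑ * wt w' ρ' (ψ p) ≤ C * (‖cft f p‖ₑ * wt w ρ p)) :
    nrm w' ρ' g ≤ C * nrm w ρ f := by
  rw [nrm_eq_tsum, nrm_eq_tsum, ← hψ.tsum_eq, ← ENNReal.tsum_mul_left]
  · exact ENNReal.tsum_le_tsum h
  · intro p hp
    by_contra hc
    simp [h0 p hc] at hp

theorem nrm_mono {w w' : ℕ → ℝ≥0∞} {ρ ρ' : ℝ≥0∞} (hw : ∀ k, w' k ≤ w k) (hρ : ρ' ≤ ρ) (f : Ser) :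
    nrm w' ρ' f ≤ nrm w ρ f := by
  rw [nrm_eq_tsum, nrm_eq_tsum]
  refine ENNReal.tsum_le_tsum fun p => ?_
  unfold wt
  gcongr
  exact hw _

/-! ### Partial derivatives and primitives -/

theorem cft_pd_zero (f : Ser) (k i j : ℕ) :
    cft (pd 0 f) (k, i, j) = cft f (k, i + 1, j) * (i + 1) := by
  have : ((i : SerT2) + 1) = C ((i : ℂ) + 1) := by simp
  simp only [cft, cf, pd, coeff_mk, if_true, coeff_derivative]
  rw [this, coeff_mul_C]

theorem cft_pd_one (f : Ser) (k i j : ℕ) :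
    cft (pd 1 f) (k, i, j) = cft f (k, i, j + 1) * (j + 1) := by
  simp [cft, cf, pd, coeff_derivative]

/-- The primitive of `f` with respect to `t₁` (index `0`) or `t₂` (index `1`) which vanishes on
`t₁ = 0`, respectively on `t₂ = 0`. -/
noncomputable def itg (i : Fin 2) (f : Ser) : Ser :=
  ofCoeffs fun p => if i = 0 then
      (if p.2.1 = 0 then 0 else cft f (p.1, p.2.1 - 1, p.2.2) / (p.2.1 : ℂ))
    else (if p.2.2 = 0 then 0 else cft f (p.1, p.2.1, p.2.2 - 1) / (p.2.2 : ℂ))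

theorem pd_itg (i : Fin 2) (f : Ser) : pd i (itg i f) = f := by
  ext ⟨k, a, b⟩
  fin_cases i
  · have : (a : ℂ) + 1 ≠ 0 := by exact_mod_cast a.succ_ne_zero
    simp [cft_pd_zero, itg, this]
  · have : (b : ℂ) + 1 ≠ 0 := by exact_mod_cast b.succ_ne_zero
    simp [cft_pd_one, itg, this]

theorem itg_add (i : Fin 2) (f g : Ser) : itg i (f + g) = itg i f + itg i g := by
  ext ⟨k, a, b⟩
  fin_cases i <;> simp [itg] <;> split_ifs <;> ring

theorem pd_add (i : Fin 2) (f g : Ser) : pd i (f + g) = pd i f + pd i g := by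
  ext ⟨k, a, b⟩
  fin_cases i <;> simp [cft_pd_zero, cft_pd_one] <;> ring

theorem enorm_div_succ_le (x : ℂ) (n : ℕ) : ‖x / ((n + 1 : ℕ) : ℂ)‖ₑ ≤ ‖x‖ₑ := by
  rw [← ofReal_norm, ← ofReal_norm]
  refine ENNReal.ofReal_le_ofReal ?_
  rw [norm_div, Complex.norm_natCast]
  exact div_le_self (norm_nonneg _) (by simp)

theorem nrm_itg_le (w : ℕ → ℝ≥0∞) (ρ : ℝ≥0∞) (i : Fin 2) (f : Ser) :
    nrm w ρ (itg i f) ≤ ρ * nrm w ρ f := by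
  fin_cases i
  · refine nrm_le_of_support (ψ := fun p => (p.1, p.2.1 + 1, p.2.2)) ?_ ?_ ?_
    · rintro ⟨a, b, c⟩ ⟨a', b', c'⟩ h
      simpa using h
    · rintro ⟨k, a, b⟩ hp
      rcases a with _ | a
      · simp [itg]
      · exact absurd ⟨(k, a, b), rfl⟩ hp
    · rintro ⟨k, a, b⟩
      simp only [itg, Fin.zero_eta, cft_ofCoeffs, if_true, Nat.succ_ne_zero, if_false, wt,
        Nat.add_sub_cancel]
      calc _ ≤ ‖cft f (k, a, b)‖ₑ * (w k * ρ ^ (a + 1) * ρ ^ b) := by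
            gcongr; exact enorm_div_succ_le _ _
        _ = _ := by ring
  · refine nrm_le_of_support (ψ := fun p => (p.1, p.2.1, p.2.2 + 1)) ?_ ?_ ?_
    · rintro ⟨a, b, c⟩ ⟨a', b', c'⟩ h
      simpa using h
    · rintro ⟨k, a, b⟩ hp
      rcases b with _ | b
      · simp [itg]
      · exact absurd ⟨(k, a, b), rfl⟩ hp
    · rintro ⟨k, a, b⟩
      simp only [itg, Fin.mk_one, one_ne_zero, cft_ofCoeffs, Nat.succ_ne_zero, if_false, wt,
        Nat.add_sub_cancel]
      calc _ ≤ ‖cft f (k, a, b)‖ₑ * (w k * ρ ^ a * ρ ^ (b + 1)) := by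
            gcongr; exact enorm_div_succ_le _ _
        _ = _ := by ring

theorem succ_mul_half_pow_le (ρ : ℝ≥0∞) (n : ℕ) : ((n : ℝ≥0∞) + 1) * (ρ / 2) ^ n ≤ ρ ^ n := by
  have h2 : ((n : ℝ≥0∞) + 1) ≤ 2 ^ n := by
    have : n + 1 ≤ 2 ^ n := Nat.lt_two_pow_self
    exact_mod_cast this
  calc ((n : ℝ≥0∞) + 1) * (ρ / 2) ^ n ≤ 2 ^ n * (ρ / 2) ^ n := by gcongr
    _ = ρ ^ n := by rw [← mul_pow, ENNReal.mul_div_cancel (by simp) (by simp)]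

/-- Differentiation is bounded at the cost of halving the radius. -/
theorem nrm_pd_le (w : ℕ → ℝ≥0∞) {ρ : ℝ≥0∞} (h0 : ρ ≠ 0) (h1 : ρ ≠ ∞) (i : Fin 2) (f : Ser) :
    nrm w (ρ / 2) (pd i f) ≤ ρ⁻¹ * nrm w ρ f := by
  have hhalf : ∀ n : ℕ, (ρ / 2) ^ n ≤ ρ ^ n := fun n => by gcongr; exact ENNReal.half_le_self
  have hn : ∀ n : ℕ, ‖(n : ℂ) + 1‖ₑ = (n : ℝ≥0∞) + 1 := fun n => by
    have : ((n : ℂ) + 1) = ((n + 1 : ℕ) : ℂ) := by simp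
    rw [this, ← ofReal_norm, Complex.norm_natCast, ENNReal.ofReal_natCast]; simp
  have hs : ∀ n : ℕ, ρ ^ n = ρ⁻¹ * ρ ^ (n + 1) := fun n => by
    rw [pow_succ', ← mul_assoc, ENNReal.inv_mul_cancel h0 h1, one_mul]
  fin_cases i
  · refine nrm_le_of_injective (φ := fun p => (p.1, p.2.1 + 1, p.2.2)) ?_ ?_
    · rintro ⟨a, b, c⟩ ⟨a', b', c'⟩ h
      simpa using h
    · rintro ⟨k, a, b⟩
      simp only [Fin.zero_eta, cft_pd_zero, enorm_mul, wt, hn]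
      calc _ = ‖cft f (k, a + 1, b)‖ₑ * (w k * (((a : ℝ≥0∞) + 1) * (ρ / 2) ^ a) * (ρ / 2) ^ b) := by
            ring
        _ ≤ ‖cft f (k, a + 1, b)‖ₑ * (w k * ρ ^ a * ρ ^ b) := by
            gcongr
            · exact succ_mul_half_pow_le ρ a
            · exact ENNReal.half_le_self
        _ = _ := by rw [hs]; ring
  · refine nrm_le_of_injective (φ := fun p => (p.1, p.2.1, p.2.2 + 1)) ?_ ?_
    · rintro ⟨a, b, c⟩ ⟨a', b', c'⟩ h
      simpa using h
    · rintro ⟨k, a, b⟩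
      simp only [Fin.mk_one, cft_pd_one, enorm_mul, wt, hn]
      calc _ = ‖cft f (k, a, b + 1)‖ₑ * (w k * (ρ / 2) ^ a * (((b : ℝ≥0∞) + 1) * (ρ / 2) ^ b)) := by
            ring
        _ ≤ ‖cft f (k, a, b + 1)‖ₑ * (w k * ρ ^ a * ρ ^ b) := by
            gcongr
            · exact ENNReal.half_le_self
            · exact succ_mul_half_pow_le ρ b
        _ = _ := by rw [hs b]; ring

/-! ### Weights for the variable `z` -/

/-- A weight sequence for the powers of `z`: positive, bounded by `1`, submultiplicative. -/
structure IsWeight (w : ℕ → ℝ≥0∞) : Prop where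
  map_zero : w 0 = 1
  add_le : ∀ j k, w (j + k) ≤ w j * w k
  ne_zero : ∀ k, w k ≠ 0
  le_one : ∀ k, w k ≤ 1

theorem isWeight_pow {ε : ℝ≥0∞} (h0 : ε ≠ 0) (h1 : ε ≤ 1) : IsWeight (ε ^ ·) where
  map_zero := pow_zero _
  add_le := pow_submul ε
  ne_zero k := pow_ne_zero k h0
  le_one k := pow_le_one₀ (by simp) h1

theorem IsWeight.mul {w w' : ℕ → ℝ≥0∞} (h : IsWeight w) (h' : IsWeight w') :
    IsWeight (fun k => w k * w' k) where
  map_zero := by simp [h.map_zero, h'.map_zero]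
  add_le j k := by
    calc w (j + k) * w' (j + k) ≤ (w j * w k) * (w' j * w' k) :=
          mul_le_mul' (h.add_le _ _) (h'.add_le _ _)
      _ = _ := by ring
  ne_zero k := mul_ne_zero (h.ne_zero k) (h'.ne_zero k)
  le_one k := mul_le_one' (h.le_one k) (h'.le_one k)

/-- Weights can decay arbitrarily fast: if `c` is decreasing, then `k ↦ c k ^ k` is
submultiplicative. -/
theorem exists_weight_le (m : ℕ → ℝ≥0∞) (hm : ∀ k, m k ≠ 0) :
    ∃ w, IsWeight w ∧ ∀ k, 1 ≤ k → w k ≤ m k := by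
  let c : ℕ → ℝ≥0∞ := fun k => (Finset.range (k + 1)).inf m ⊓ 1
  have hc1 : ∀ k, c k ≤ 1 := fun k => inf_le_right
  have hcm : ∀ k, c k ≤ m k := fun k =>
    inf_le_left.trans (Finset.inf_le (Finset.self_mem_range_succ k))
  have hanti : ∀ j k, j ≤ k → c k ≤ c j := fun j k h =>
    inf_le_inf_right _ (Finset.inf_mono (Finset.range_mono (by omega)))
  have hpos : ∀ k, c k ≠ 0 := fun k => by
    refine (lt_inf_iff.2 ⟨?_, zero_lt_one⟩).ne'
    exact (Finset.lt_inf_iff (by simp)).2 fun b _ => (hm b).bot_lt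
  refine ⟨fun k => c k ^ k, ⟨by simp, fun j k => ?_, fun k => pow_ne_zero _ (hpos k), fun k => ?_⟩,
    fun k hk => ?_⟩
  · rw [pow_add]
    gcongr
    · exact hanti _ _ (by omega)
    · exact hanti _ _ (by omega)
  · exact pow_le_one₀ (by simp) (hc1 k)
  · exact (pow_le_of_le_one (by simp) (hc1 k) (by omega)).trans (hcm k)

/-- A class of weights which allows the constructions below; there are two instances, one for
`ℂ{t, z}` and one for `ℂ{t, z]]`. Products provide common weights for several series, the geometric
weights make the norms of series without constant term small, and `shift` permits division by
`z`. -/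
structure IsWeightClass (W : Set (ℕ → ℝ≥0∞)) : Prop where
  isWeight : ∀ w ∈ W, IsWeight w
  mul : ∀ w ∈ W, ∀ w' ∈ W, (fun k => w k * w' k) ∈ W
  pow : ∀ ε : ℝ≥0∞, ε ≠ 0 → ε ≤ 1 → (ε ^ ·) ∈ W
  shift : ∀ w ∈ W, ∃ w' ∈ W, ∃ C : ℝ≥0∞, C ≠ ∞ ∧ ∀ k, w' k ≤ C * w (k + 1)

/-- The geometric weights, which describe convergence in `z`. -/
def geomWeights : Set (ℕ → ℝ≥0∞) := {w | ∃ ε : ℝ≥0∞, ε ≠ 0 ∧ ε ≤ 1 ∧ w = (ε ^ ·)}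

theorem isWeightClass_geomWeights : IsWeightClass geomWeights where
  isWeight := by
    rintro w ⟨ε, h0, h1, rfl⟩
    exact isWeight_pow h0 h1
  mul := by
    rintro w ⟨ε, h0, h1, rfl⟩ w' ⟨ε', h0', h1', rfl⟩
    exact ⟨ε * ε', mul_ne_zero h0 h0', mul_le_one' h1 h1', by ext k; simp [mul_pow]⟩
  pow ε h0 h1 := ⟨ε, h0, h1, rfl⟩
  shift := by
    rintro w ⟨ε, h0, h1, rfl⟩
    refine ⟨_, ⟨ε, h0, h1, rfl⟩, ε⁻¹, by simpa using h0, fun k => ?_⟩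
    simp only [pow_succ', ← mul_assoc,
      ENNReal.inv_mul_cancel h0 (h1.trans_lt ENNReal.one_lt_top).ne, one_mul, le_refl]

theorem isWeightClass_isWeight : IsWeightClass {w | IsWeight w} where
  isWeight _ h := h
  mul _ h _ h' := h.mul h'
  pow _ h0 h1 := isWeight_pow h0 h1
  shift := by
    intro w hw
    obtain ⟨w', hw', h⟩ := exists_weight_le (fun k => w (k + 1)) (fun k => hw.ne_zero _)
    have h1 : w 1 ≠ ∞ := ((hw.le_one 1).trans_lt ENNReal.one_lt_top).ne
    refine ⟨w', hw', (w 1)⁻¹, by simpa using hw.ne_zero 1, fun k => ?_⟩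
    rcases Nat.eq_zero_or_pos k with rfl | hk
    · simp [hw'.map_zero, ENNReal.inv_mul_cancel (hw.ne_zero 1) h1]
    · calc w' k ≤ 1 * w (k + 1) := by simpa using h k hk
        _ ≤ _ := by
          gcongr
          exact ENNReal.one_le_inv.2 (hw.le_one 1)

/-! ### The ring of series attached to a class of weights -/

/-- The series of finite weighted norm, for some weight in `W` and some positive radius in `t`. -/
def conv (W : Set (ℕ → ℝ≥0∞)) : Set Ser :=
  {f | ∃ w ∈ W, ∃ ρ : ℝ≥0∞, ρ ≠ 0 ∧ ρ ≤ 1 ∧ nrm w ρ f ≠ ∞}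

theorem tsum_ofReal_ne_top_iff {ι : Type*} {a : ι → ℝ} (ha : ∀ i, 0 ≤ a i) :
    ∑' i, ENNReal.ofReal (a i) ≠ ∞ ↔ Summable a := by
  constructor
  · intro h
    exact (ENNReal.summable_toReal h).congr fun i => ENNReal.toReal_ofReal (ha i)
  · intro h
    rw [← ENNReal.ofReal_tsum_of_nonneg ha h]
    exact ENNReal.ofReal_ne_top

theorem holomorphicSeries_eq : holomorphicSeries = conv geomWeights := by
  have key : ∀ (f : Ser) (r : ℝ), 0 < r →
      ((Summable fun p : ℕ × ℕ × ℕ => ‖cf f p.1 p.2.1 p.2.2‖ * r ^ (p.1 + p.2.1 + p.2.2)) ↔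
        nrm (ENNReal.ofReal r ^ ·) (ENNReal.ofReal r) f ≠ ∞) := by
    intro f r hr
    rw [nrm_eq_tsum, ← tsum_ofReal_ne_top_iff (fun _ => by positivity)]
    refine Iff.of_eq (congrArg (· ≠ ∞) (tsum_congr fun p => ?_))
    rw [ENNReal.ofReal_mul (norm_nonneg _), ofReal_norm, ENNReal.ofReal_pow hr.le]
    simp only [wt, cft, pow_add]
  ext f
  constructor
  · rintro ⟨r, hr, h⟩
    have hm : 0 < min r 1 := lt_min hr one_pos
    have h1 : ENNReal.ofReal (min r 1) ≤ 1 := by simp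
    have h0 : ENNReal.ofReal (min r 1) ≠ 0 := by simpa using hr
    refine ⟨_, ⟨_, h0, h1, rfl⟩, _, h0, h1, (key f _ hm).1 ?_⟩
    refine h.of_nonneg_of_le (fun _ => by positivity) fun p => ?_
    gcongr
    exact min_le_left _ _
  · rintro ⟨w, ⟨ε, h0, h1, rfl⟩, ρ, hρ0, hρ1, h⟩
    have hm0 : min ε ρ ≠ 0 := by
      rcases min_choice ε ρ with h | h <;> rw [h] <;> assumption
    have hmt : min ε ρ ≠ ∞ := ((min_le_left _ _).trans_lt (h1.trans_lt ENNReal.one_lt_top)).ne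
    have hr : 0 < (min ε ρ).toReal := ENNReal.toReal_pos hm0 hmt
    refine ⟨_, hr, (key f _ hr).2 ?_⟩
    rw [ENNReal.ofReal_toReal hmt]
    refine ne_top_of_le_ne_top h (nrm_mono (fun k => ?_) (min_le_right _ _) f)
    gcongr
    exact min_le_left _ _

/-- The norm of `∑ a_{ij} t₁ ^ i t₂ ^ j`. -/
noncomputable def nrmT (ρ : ℝ≥0∞) : SerT → ℝ≥0∞ :=
  wnorm (wnorm (fun x : ℂ => ‖x‖ₑ) (ρ ^ ·)) (ρ ^ ·)

theorem nrm_eq_tsum_nrmT (w : ℕ → ℝ≥0∞) (ρ : ℝ≥0∞) (f : Ser) :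
    nrm w ρ f = ∑' k, nrmT ρ (coeff k f) * w k := rfl

theorem summable_iff_nrmT_ne_top (f : Ser) (k : ℕ) {r : ℝ} (hr : 0 < r) :
    (Summable fun p : ℕ × ℕ => ‖cf f k p.1 p.2‖ * r ^ (p.1 + p.2)) ↔
      nrmT (ENNReal.ofReal r) (coeff k f) ≠ ∞ := by
  rw [← tsum_ofReal_ne_top_iff (fun _ => by positivity)]
  refine Iff.of_eq (congrArg (· ≠ ∞) ?_)
  rw [ENNReal.tsum_prod']
  refine tsum_congr fun i => ?_
  rw [wnorm, ← ENNReal.tsum_mul_right]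
  refine tsum_congr fun j => ?_
  rw [ENNReal.ofReal_mul (norm_nonneg _), ofReal_norm, ENNReal.ofReal_pow hr.le, cf, pow_add]
  ring

theorem formalSeries_eq : formalSeries = conv {w | IsWeight w} := by
  ext f
  constructor
  · rintro ⟨r, hr, h⟩
    have hm : 0 < min r 1 := lt_min hr one_pos
    have h1 : ENNReal.ofReal (min r 1) ≤ 1 := by simp
    have h0 : ENNReal.ofReal (min r 1) ≠ 0 := by simpa using hr
    set ρ := ENNReal.ofReal (min r 1) with hρ
    have hN : ∀ k, nrmT ρ (coeff k f) ≠ ∞ := fun k => by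
      refine (summable_iff_nrmT_ne_top f k hm).1 ?_
      refine (h k).of_nonneg_of_le (fun _ => by positivity) fun p => ?_
      gcongr
      exact min_le_left _ _
    obtain ⟨w, hw, hle⟩ := exists_weight_le
      (fun k => 2⁻¹ ^ k * (1 + nrmT ρ (coeff k f))⁻¹) (fun k => by
        refine mul_ne_zero (pow_ne_zero _ (by simp)) ?_
        simpa using hN k)
    refine ⟨w, hw, ρ, h0, h1, ?_⟩
    rw [nrm_eq_tsum_nrmT, tsum_eq_zero_add' ENNReal.summable]
    refine ENNReal.add_ne_top.2 ⟨by simpa [hw.map_zero] using hN 0, ?_⟩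
    have hgeom : ∑' k : ℕ, (2⁻¹ : ℝ≥0∞) ^ (k + 1) ≠ ∞ := by
      rw [ENNReal.tsum_geometric_add_one]
      simp
    refine ne_top_of_le_ne_top hgeom (ENNReal.tsum_le_tsum fun k => ?_)
    have ht : 1 + nrmT ρ (coeff (k + 1) f) ≠ ∞ := by simpa using hN (k + 1)
    calc nrmT ρ (coeff (k + 1) f) * w (k + 1)
        ≤ (1 + nrmT ρ (coeff (k + 1) f)) *
            (2⁻¹ ^ (k + 1) * (1 + nrmT ρ (coeff (k + 1) f))⁻¹) :=
          mul_le_mul' le_add_self (hle (k + 1) (by omega))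
      _ = 2⁻¹ ^ (k + 1) * ((1 + nrmT ρ (coeff (k + 1) f)) *
            (1 + nrmT ρ (coeff (k + 1) f))⁻¹) := by ring
      _ = 2⁻¹ ^ (k + 1) := by rw [ENNReal.mul_inv_cancel (by simp) ht, mul_one]
  · rintro ⟨w, hw, ρ, h0, h1, h⟩
    have ht : ρ ≠ ∞ := (h1.trans_lt ENNReal.one_lt_top).ne
    have hr : 0 < ρ.toReal := ENNReal.toReal_pos h0 ht
    refine ⟨_, hr, fun k => (summable_iff_nrmT_ne_top f k hr).2 ?_⟩
    rw [ENNReal.ofReal_toReal ht]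
    intro hc
    refine h (top_le_iff.1 ?_)
    rw [nrm_eq_tsum_nrmT]
    refine le_trans ?_ (ENNReal.le_tsum k)
    rw [hc, ENNReal.top_mul (hw.ne_zero k)]

namespace IsWeightClass

variable {W : Set (ℕ → ℝ≥0∞)}

theorem exists_common_two (hW : IsWeightClass W) {w w' : ℕ → ℝ≥0∞} (hw : w ∈ W) (hw' : w' ∈ W)
    {ρ ρ' : ℝ≥0∞} (h : ρ ≠ 0) (h' : ρ' ≠ 0) (h1 : ρ ≤ 1) :
    ∃ w'' ∈ W, ∃ ρ'' : ℝ≥0∞, ρ'' ≠ 0 ∧ ρ'' ≤ 1 ∧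
      (∀ f, nrm w'' ρ'' f ≤ nrm w ρ f) ∧ (∀ f, nrm w'' ρ'' f ≤ nrm w' ρ' f) := by
  refine ⟨_, hW.mul w hw w' hw', min ρ ρ', ?_, (min_le_left _ _).trans h1, fun f => ?_, fun f => ?_⟩
  · rcases min_choice ρ ρ' with h | h <;> rw [h] <;> assumption
  · exact nrm_mono (fun k => mul_le_of_le_one_right' ((hW.isWeight w' hw').le_one k))
      (min_le_left _ _) f
  · exact nrm_mono (fun k => mul_le_of_le_one_left' ((hW.isWeight w hw).le_one k))
      (min_le_right _ _) f

/-- Finitely many elements of `conv W` have finite norm for a common weight and radius. -/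
theorem exists_common (hW : IsWeightClass W) {ι : Type*} [Finite ι] (f : ι → Ser)
    (hf : ∀ i, f i ∈ conv W) :
    ∃ w ∈ W, ∃ ρ : ℝ≥0∞, ρ ≠ 0 ∧ ρ ≤ 1 ∧ ∀ i, nrm w ρ (f i) ≠ ∞ := by
  classical
  have := Fintype.ofFinite ι
  suffices H : ∀ s : Finset ι, ∃ w ∈ W, ∃ ρ : ℝ≥0∞, ρ ≠ 0 ∧ ρ ≤ 1 ∧ ∀ i ∈ s, nrm w ρ (f i) ≠ ∞ by
    simpa using H Finset.univ
  intro s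
  induction s using Finset.induction_on with
  | empty => exact ⟨_, hW.pow 1 one_ne_zero le_rfl, 1, one_ne_zero, le_rfl, by simp⟩
  | insert a s ha ih =>
    obtain ⟨w, hw, ρ, h0, h1, h⟩ := ih
    obtain ⟨w', hw', ρ', h0', h1', h'⟩ := hf a
    obtain ⟨w'', hw'', ρ'', h0'', h1'', H, H'⟩ := hW.exists_common_two hw hw' h0 h0' h1
    refine ⟨w'', hw'', ρ'', h0'', h1'', fun i hi => ?_⟩
    rcases Finset.mem_insert.1 hi with rfl | hi
    · exact ne_top_of_le_ne_top h' (H' _)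
    · exact ne_top_of_le_ne_top (h i hi) (H _)

theorem isSubmulNorm (hW : IsWeightClass W) {w : ℕ → ℝ≥0∞} (hw : w ∈ W) (ρ : ℝ≥0∞) :
    IsSubmulNorm (nrm w ρ) := isSubmulNorm_nrm (hW.isWeight w hw).add_le ρ

theorem add_mem (hW : IsWeightClass W) {f g : Ser} (hf : f ∈ conv W) (hg : g ∈ conv W) :
    f + g ∈ conv W := by
  obtain ⟨w, hw, ρ, h0, h1, h⟩ := hW.exists_common ![f, g] (by simp [Fin.forall_fin_two, hf, hg])
  rw [Fin.forall_fin_two] at h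
  exact ⟨w, hw, ρ, h0, h1, ne_top_of_le_ne_top (ENNReal.add_ne_top.2 h)
    ((hW.isSubmulNorm hw ρ).add_le _ _)⟩

theorem mul_mem (hW : IsWeightClass W) {f g : Ser} (hf : f ∈ conv W) (hg : g ∈ conv W) :
    f * g ∈ conv W := by
  obtain ⟨w, hw, ρ, h0, h1, h⟩ := hW.exists_common ![f, g] (by simp [Fin.forall_fin_two, hf, hg])
  rw [Fin.forall_fin_two] at h
  exact ⟨w, hw, ρ, h0, h1, ne_top_of_le_ne_top (ENNReal.mul_ne_top h.1 h.2)
    ((hW.isSubmulNorm hw ρ).mul_le _ _)⟩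

/-- A series with finitely many non-zero coefficients lies in every `conv W`. -/
theorem mem_of_finite (hW : IsWeightClass W) {f : Ser} (s : Finset (ℕ × ℕ × ℕ))
    (hf : ∀ p ∉ s, cft f p = 0) : f ∈ conv W := by
  refine ⟨_, hW.pow 1 one_ne_zero le_rfl, 1, one_ne_zero, le_rfl, ?_⟩
  rw [nrm_eq_tsum, tsum_eq_sum (s := s) (fun p hp => by simp [hf p hp])]
  simp [wt, ENNReal.sum_eq_top]

theorem mem_of_const (hW : IsWeightClass W) (c : ℂ) : (C (C (C c)) : Ser) ∈ conv W := by
  refine hW.mem_of_finite {(0, 0, 0)} ?_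
  rintro ⟨k, i, j⟩ hp
  simp only [Finset.mem_singleton, Prod.mk.injEq, not_and_or] at hp
  by_cases hk : k = 0 <;> by_cases hi : i = 0 <;> by_cases hj : j = 0 <;>
    simp_all [cft, cf, coeff_C]

theorem zero_mem (hW : IsWeightClass W) : (0 : Ser) ∈ conv W := by
  simpa using hW.mem_of_const 0

theorem one_mem (hW : IsWeightClass W) : (1 : Ser) ∈ conv W := by
  simpa using hW.mem_of_const 1

theorem z_mem (hW : IsWeightClass W) : z ∈ conv W := by
  refine hW.mem_of_finite {(1, 0, 0)} ?_
  rintro ⟨k, i, j⟩ hp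
  simp only [Finset.mem_singleton, Prod.mk.injEq, not_and_or] at hp
  by_cases hk : k = 1 <;> by_cases hi : i = 0 <;> by_cases hj : j = 0 <;>
    simp_all [cft, cf, z, coeff_X, coeff_one]

theorem neg_mem (hW : IsWeightClass W) {f : Ser} (hf : f ∈ conv W) : -f ∈ conv W := by
  have := hW.mul_mem (hW.mem_of_const (-1)) hf
  simpa using this

theorem sub_mem (hW : IsWeightClass W) {f g : Ser} (hf : f ∈ conv W) (hg : g ∈ conv W) :
    f - g ∈ conv W := by
  simpa [sub_eq_add_neg] using hW.add_mem hf (hW.neg_mem hg)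

theorem sum_mem (hW : IsWeightClass W) {ι : Type*} (s : Finset ι) (f : ι → Ser)
    (hf : ∀ i ∈ s, f i ∈ conv W) : ∑ i ∈ s, f i ∈ conv W := by
  classical
  induction s using Finset.induction_on with
  | empty => simpa using hW.zero_mem
  | insert a s ha ih =>
    rw [Finset.sum_insert ha]
    exact hW.add_mem (hf a (by simp)) (ih fun i hi => hf i (by simp [hi]))

theorem pd_mem (_hW : IsWeightClass W) {f : Ser} (hf : f ∈ conv W) (i : Fin 2) :
    pd i f ∈ conv W := by
  obtain ⟨w, hw, ρ, h0, h1, h⟩ := hf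
  have ht : ρ ≠ ∞ := (h1.trans_lt ENNReal.one_lt_top).ne
  refine ⟨w, hw, ρ / 2, ?_, ENNReal.half_le_self.trans h1, ne_top_of_le_ne_top ?_
    (nrm_pd_le w h0 ht i f)⟩
  · simpa using h0
  · exact ENNReal.mul_ne_top (by simpa using h0) h

/-- `conv W` is closed under division by `z`. -/
theorem mem_of_z_mul_mem (hW : IsWeightClass W) {f : Ser} (hf : z * f ∈ conv W) : f ∈ conv W := by
  obtain ⟨w, hw, ρ, h0, h1, h⟩ := hf
  obtain ⟨w', hw', c, hc, hle⟩ := hW.shift w hw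
  refine ⟨w', hw', ρ, h0, h1, ne_top_of_le_ne_top (ENNReal.mul_ne_top hc h) ?_⟩
  refine nrm_le_of_injective (φ := fun p => (p.1 + 1, p.2)) ?_ ?_
  · rintro ⟨a, b⟩ ⟨a', b'⟩ h
    simpa using h
  · rintro ⟨k, i, j⟩
    have : cft (z * f) (k + 1, i, j) = cft f (k, i, j) := by
      simp [cft, cf, z, coeff_succ_X_mul]
    simp only [this, wt]
    calc _ ≤ ‖cft f (k, i, j)‖ₑ * (c * w (k + 1) * ρ ^ i * ρ ^ j) := by
          gcongr; exact hle k
      _ = _ := by ring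

/-- `conv W` is closed under setting some of the coefficients to zero. -/
theorem mem_of_cft (_hW : IsWeightClass W) {f g : Ser} (hf : f ∈ conv W)
    (h : ∀ p, cft g p = cft f p ∨ cft g p = 0) : g ∈ conv W := by
  obtain ⟨w, hw, ρ, h0, h1, hn⟩ := hf
  refine ⟨w, hw, ρ, h0, h1, ne_top_of_le_ne_top hn ?_⟩
  rw [nrm_eq_tsum, nrm_eq_tsum]
  refine ENNReal.tsum_le_tsum fun p => ?_
  rcases h p with h | h <;> simp [h]

end IsWeightClass

/-! ### A fixed point theorem, linear differential equations and inverses -/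

/-- All coefficients of total degree `< n` of the components of `x` vanish. -/
def OrdGE {ι : Type*} (n : ℕ) (x : ι → Ser) : Prop :=
  ∀ a p, p.1 + p.2.1 + p.2.2 < n → cft (x a) p = 0

theorem eq_zero_of_ordGE {ι : Type*} {x : ι → Ser} (h : ∀ n, OrdGE n x) : x = 0 := by
  funext a
  refine ser_ext fun p => ?_
  simpa using h _ a p (Nat.lt_succ_self _)

theorem OrdGE.add {ι : Type*} {n : ℕ} {x y : ι → Ser} (hx : OrdGE n x) (hy : OrdGE n y) :
    OrdGE n (x + y) := fun a p hp => by simp [hx a p hp, hy a p hp]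

theorem OrdGE.neg {ι : Type*} {n : ℕ} {x : ι → Ser} (hx : OrdGE n x) :
    OrdGE n (-x) := fun a p hp => by simp [hx a p hp]

theorem OrdGE.mono {ι : Type*} {m n : ℕ} {x : ι → Ser} (hx : OrdGE n x) (h : m ≤ n) :
    OrdGE m x := fun a p hp => hx a p (by omega)

/-- If `L` raises the total degree and is a contraction for a weighted norm, then `x = y + L x` has
a solution of finite norm, namely `∑ Lⁿ y`. The sum is finite in every degree, so that the
solution can be defined coefficientwise. -/
theorem exists_fixed_point {ι : Type*} [Fintype ι] (L : (ι → Ser) →+ (ι → Ser))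
    (hL : ∀ n x, OrdGE n x → OrdGE (n + 1) (L x)) (w : ℕ → ℝ≥0∞) (ρ c : ℝ≥0∞) (hc : c < 1)
    (hN : ∀ x, ∑ a, nrm w ρ (L x a) ≤ c * ∑ a, nrm w ρ (x a))
    (y : ι → Ser) (hy : ∀ a, nrm w ρ (y a) ≠ ∞) :
    ∃ x : ι → Ser, x = y + L x ∧ ∀ a, nrm w ρ (x a) ≠ ∞ := by
  let s : ℕ → ι → Ser := fun n => (fun x => L x)^[n] y
  have hs : ∀ n, s (n + 1) = L (s n) := fun n => Function.iterate_succ_apply' _ _ _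
  have hord : ∀ n, OrdGE n (s n) := fun n => by
    induction n with
    | zero => exact fun a p hp => absurd hp (by omega)
    | succ n ih => rw [hs]; exact hL _ _ ih
  let X : ι → Ser := fun a => ofCoeffs fun p =>
    ∑ n ∈ Finset.range (p.1 + p.2.1 + p.2.2 + 1), cft (s n a) p
  have hX : ∀ m, OrdGE m (X - ∑ n ∈ Finset.range m, s n) := fun m a p hp => by
    simp only [Pi.sub_apply, cft_sub, Finset.sum_apply, cft_sum, X, cft_ofCoeffs]
    rw [sub_eq_zero]
    refine Finset.sum_subset (Finset.range_mono (by omega)) fun n _ hn => ?_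
    exact hord n a p (by simpa using hn)
  refine ⟨X, ?_, fun a => ?_⟩
  · rw [← sub_eq_zero]
    refine eq_zero_of_ordGE fun m => ?_
    have h1 := hX (m + 1)
    have h2 := (hL _ _ (hX m)).neg
    have h3 : X - (y + L X) = (X - ∑ n ∈ Finset.range (m + 1), s n) +
        -L (X - ∑ n ∈ Finset.range m, s n) := by
      rw [map_sub, map_sum, Finset.sum_range_succ']
      simp_rw [hs]
      have : s 0 = y := rfl
      rw [this]
      abel
    rw [h3]
    exact (h1.add h2).mono (Nat.le_succ m)
  · have hbound : ∀ n, ∑ a, nrm w ρ (s n a) ≤ c ^ n * ∑ a, nrm w ρ (y a) := fun n => by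
      induction n with
      | zero => simp [s]
      | succ n ih =>
        rw [hs, pow_succ', mul_assoc]
        exact (hN _).trans (by gcongr)
    have hle : nrm w ρ (X a) ≤ ∑' n, nrm w ρ (s n a) := by
      simp_rw [nrm_eq_tsum]
      rw [ENNReal.tsum_comm]
      refine ENNReal.tsum_le_tsum fun p => ?_
      rw [ENNReal.tsum_mul_right]
      gcongr
      simp only [X, cft_ofCoeffs]
      exact (enorm_sum_le _ _).trans (ENNReal.sum_le_tsum _)
    have hgeom : ∑' n, c ^ n * ∑ a, nrm w ρ (y a) ≠ ∞ := by
      rw [ENNReal.tsum_mul_right, ENNReal.tsum_geometric]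
      refine ENNReal.mul_ne_top ?_ (ENNReal.sum_ne_top.2 fun a _ => hy a)
      rw [ENNReal.inv_ne_top, ← pos_iff_ne_zero]
      exact tsub_pos_of_lt hc
    refine ne_top_of_le_ne_top hgeom (hle.trans (ENNReal.tsum_le_tsum fun n => ?_))
    exact (Finset.single_le_sum (f := fun a => nrm w ρ (s n a)) (fun _ _ => zero_le)
      (Finset.mem_univ a)).trans (hbound n)

theorem cft_mul_eq_zero {f g : Ser} {n : ℕ}
    (hg : ∀ p : ℕ × ℕ × ℕ, p.1 + p.2.1 + p.2.2 < n → cft g p = 0) {p : ℕ × ℕ × ℕ}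
    (hp : p.1 + p.2.1 + p.2.2 < n) : cft (f * g) p = 0 := by
  rw [cft_mul]
  refine Finset.sum_eq_zero fun a ha => Finset.sum_eq_zero fun b hb =>
    Finset.sum_eq_zero fun c hc => ?_
  rw [Finset.HasAntidiagonal.mem_antidiagonal] at ha hb hc
  rw [hg _ (by simp only; omega), mul_zero]

theorem cft_mul_eq_zero' {f g : Ser} {n : ℕ} (hf : cft f (0, 0, 0) = 0)
    (hg : ∀ p : ℕ × ℕ × ℕ, p.1 + p.2.1 + p.2.2 < n → cft g p = 0) {p : ℕ × ℕ × ℕ}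
    (hp : p.1 + p.2.1 + p.2.2 < n + 1) : cft (f * g) p = 0 := by
  rw [cft_mul]
  refine Finset.sum_eq_zero fun a ha => Finset.sum_eq_zero fun b hb =>
    Finset.sum_eq_zero fun c hc => ?_
  rw [Finset.HasAntidiagonal.mem_antidiagonal] at ha hb hc
  by_cases h : a.1 = 0 ∧ b.1 = 0 ∧ c.1 = 0
  · rw [h.1, h.2.1, h.2.2, hf, zero_mul]
  · rw [hg _ (by simp only; omega), mul_zero]

theorem cft_itg_eq_zero {f : Ser} {n : ℕ} (i : Fin 2)
    (hf : ∀ p : ℕ × ℕ × ℕ, p.1 + p.2.1 + p.2.2 < n → cft f p = 0) {p : ℕ × ℕ × ℕ}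
    (hp : p.1 + p.2.1 + p.2.2 < n + 1) : cft (itg i f) p = 0 := by
  obtain ⟨k, a, b⟩ := p
  simp only at hp
  fin_cases i
  · rcases a with _ | a
    · simp [itg]
    · simp [itg, hf (k, a, b) (by simp only; omega)]
  · rcases b with _ | b
    · simp [itg]
    · simp [itg, hf (k, a, b) (by simp only; omega)]

namespace IsWeightClass

variable {W : Set (ℕ → ℝ≥0∞)}

/-- Linear differential equations with coefficients in `conv W` have solutions in `conv W`. The
equation `∂ᵢ Y = M Y` is stated in its integrated form. -/
theorem exists_ode (hW : IsWeightClass W) {ι : Type*} [Fintype ι] (i : Fin 2)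
    (M : ι → ι → Ser) (hM : ∀ a b, M a b ∈ conv W) (y : ι → Ser) (hy : ∀ a, y a ∈ conv W) :
    ∃ Y : ι → Ser, (∀ a, Y a ∈ conv W) ∧ ∀ a, Y a = y a + itg i (∑ b, M a b * Y b) := by
  obtain ⟨w, hw, ρ, h0, h1, h⟩ := hW.exists_common
    (Sum.elim (fun p : ι × ι => M p.1 p.2) y) (by rintro (p | a) <;> simp [hM, hy])
  have hMn : ∀ a b, nrm w ρ (M a b) ≠ ∞ := fun a b => h (Sum.inl (a, b))
  have hyn : ∀ a, nrm w ρ (y a) ≠ ∞ := fun a => h (Sum.inr a)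
  set K := ∑ a, ∑ b, nrm w ρ (M a b) with hK
  have hKt : K ≠ ∞ := ENNReal.sum_ne_top.2 fun a _ => ENNReal.sum_ne_top.2 fun b _ => hMn a b
  -- the integration operator contracts once the radius is small compared to the norm of `M`
  obtain ⟨σ, hσ0, hσ⟩ : ∃ σ : ℝ≥0∞, σ ≠ 0 ∧ σ * K < 1 := by
    refine ⟨(K + 2)⁻¹, by simpa using hKt, ?_⟩
    have h2 : K + 2 ≠ 0 := by simp
    have h2t : K + 2 ≠ ∞ := by simpa using hKt
    calc (K + 2)⁻¹ * K < (K + 2)⁻¹ * (K + 2) := by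
          refine (ENNReal.mul_lt_mul_iff_right (by simpa using hKt) (by simp)).2 ?_
          exact ENNReal.lt_add_right hKt (by simp)
      _ = 1 := ENNReal.inv_mul_cancel h2 h2t
  set τ := min σ ρ with hτ
  have hτ0 : τ ≠ 0 := by
    rcases min_choice σ ρ with h | h <;> rw [hτ, h] <;> assumption
  have hmono : ∀ f, nrm w τ f ≤ nrm w ρ f := nrm_mono (fun _ => le_rfl) (min_le_right _ _)
  have hsub := hW.isSubmulNorm hw τ
  let L : (ι → Ser) →+ (ι → Ser) :=
    { toFun := fun x a => itg i (∑ b, M a b * x b)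
      map_zero' := by
        funext a
        have := itg_add i 0 0
        simpa using this
      map_add' := fun x y => by
        funext a
        simp only [Pi.add_apply, mul_add, Finset.sum_add_distrib, itg_add] }
  obtain ⟨x, hx, hxn⟩ := exists_fixed_point L (fun n x hx a p hp => by
      refine cft_itg_eq_zero i (fun q hq => ?_) hp
      rw [cft_sum]
      exact Finset.sum_eq_zero fun b _ => cft_mul_eq_zero (hx b) hq)
    w τ (τ * K) ((mul_le_mul_left (min_le_left _ _) K).trans_lt hσ) (fun x => by
      calc ∑ a, nrm w τ (L x a) ≤ ∑ a, τ * ∑ b, nrm w ρ (M a b) * ∑ b, nrm w τ (x b) := by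
            refine Finset.sum_le_sum fun a _ => (nrm_itg_le w τ i _).trans ?_
            gcongr
            refine (hsub.sum_le _ _).trans (Finset.sum_le_sum fun b _ => ?_)
            refine (hsub.mul_le _ _).trans (mul_le_mul' (hmono _) ?_)
            exact Finset.single_le_sum (f := fun a => nrm w τ (x a)) (fun _ _ => zero_le)
              (Finset.mem_univ b)
        _ = τ * K * ∑ b, nrm w τ (x b) := by
            simp_rw [hK, ← Finset.sum_mul, ← Finset.mul_sum, mul_assoc, Finset.sum_mul])
    y (fun a => ne_top_of_le_ne_top (hyn a) (hmono _))
  exact ⟨x, fun a => ⟨w, hw, τ, hτ0, (min_le_right _ _).trans h1, hxn a⟩, fun a => congrFun hx a⟩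

/-- `conv W` is closed under inverses. -/
theorem mem_of_mul_eq_one (hW : IsWeightClass W) {f g : Ser} (hf : f ∈ conv W) (hfg : f * g = 1) :
    g ∈ conv W := by
  have h00 : cft f (0, 0, 0) * cft g (0, 0, 0) = 1 := by
    have := congrArg (fun f => cft f (0, 0, 0)) hfg
    simpa [cft_mul, cft, cf] using this
  set c := cft f (0, 0, 0) with hc
  have hc0 : c ≠ 0 := left_ne_zero_of_mul_eq_one h00
  -- `f = c (1 - h)` with `h` without constant term
  set h : Ser := 1 - C (C (C c⁻¹)) * f with hh
  have hh0 : cft h (0, 0, 0) = 0 := by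
    have : cft (C (C (C c⁻¹)) * f) (0, 0, 0) = c⁻¹ * c := by simp [cft, cf, hc]
    rw [hh, cft_sub, this, inv_mul_cancel₀ hc0]
    simp [cft, cf]
  have hmem : h ∈ conv W := hW.sub_mem hW.one_mem (hW.mul_mem (hW.mem_of_const _) hf)
  obtain ⟨w, hw, ρ, h0, h1, hn⟩ := hmem
  set K := nrm w ρ h with hK
  -- rescaling all the variables by `ε` makes the norm of `h` small
  obtain ⟨ε, hε0, hε1, hε⟩ : ∃ ε : ℝ≥0∞, ε ≠ 0 ∧ ε ≤ 1 ∧ ε * K < 1 := by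
    refine ⟨(K + 1)⁻¹, by simpa using hn, ENNReal.inv_le_one.2 le_add_self, ?_⟩
    have h2t : K + 1 ≠ ∞ := by simpa using hn
    calc (K + 1)⁻¹ * K < (K + 1)⁻¹ * (K + 1) := by
          refine (ENNReal.mul_lt_mul_iff_right (by simpa using hn) (by simp)).2 ?_
          exact ENNReal.lt_add_right hn (by simp)
      _ = 1 := ENNReal.inv_mul_cancel (by simp) h2t
  have hw' := hW.mul w hw _ (hW.pow ε hε0 hε1)
  set w' : ℕ → ℝ≥0∞ := fun k => w k * ε ^ k with hw'_def
  have hsmall : nrm w' (ρ * ε) h ≤ ε * K := by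
    refine nrm_le_of_injective (φ := id) Function.injective_id ?_
    rintro ⟨k, i, j⟩
    by_cases hp : k + i + j = 0
    · obtain ⟨rfl, rfl, rfl⟩ : k = 0 ∧ i = 0 ∧ j = 0 := by omega
      simp [hh0]
    · simp only [wt, id, hw'_def]
      calc ‖cft h (k, i, j)‖ₑ * (w k * ε ^ k * (ρ * ε) ^ i * (ρ * ε) ^ j)
          = ε ^ (k + i + j) * (‖cft h (k, i, j)‖ₑ * (w k * ρ ^ i * ρ ^ j)) := by
            rw [pow_add, pow_add]; ring
        _ ≤ _ := by
            gcongr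
            exact pow_le_of_le_one (by simp) hε1 hp
  have hsub := hW.isSubmulNorm hw' (ρ * ε)
  let L : (Unit → Ser) →+ (Unit → Ser) :=
    { toFun := fun x a => h * x a
      map_zero' := by funext; simp
      map_add' := fun x y => by funext; simp [mul_add] }
  obtain ⟨x, hx, hxn⟩ := exists_fixed_point L
    (fun n x hx a p hp => cft_mul_eq_zero' hh0 (hx a) hp)
    w' (ρ * ε) (ε * K) hε (fun x => by
      simp only [Finset.univ_unique, Finset.sum_singleton]
      refine (hsub.mul_le _ _).trans ?_
      gcongr) (fun _ => 1) (fun _ => by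
        rw [nrm_eq_tsum, tsum_eq_single (0, 0, 0)]
        · simp [cft, cf, wt, hw'_def, ((hW.isWeight w hw).map_zero)]
        · rintro ⟨k, i, j⟩ hp
          have : cft (1 : Ser) (k, i, j) = 0 := by
            simp only [ne_eq, Prod.mk.injEq, not_and_or] at hp
            by_cases hk : k = 0 <;> by_cases hi : i = 0 <;> by_cases hj : j = 0 <;>
              simp_all [cft, cf, coeff_one]
          simp [this])
  have hx1 : x () = 1 + h * x () := congrFun hx ()
  have hxm : x () ∈ conv W := ⟨w', hw', ρ * ε, mul_ne_zero h0 hε0, mul_le_one' h1 hε1, hxn ()⟩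
  have hg : g = C (C (C c⁻¹)) * x () := by
    have h3 : C (C (C c⁻¹)) * f * x () = 1 := by
      have : C (C (C c⁻¹)) * f = 1 - h := by rw [hh]; ring
      rw [this]
      linear_combination hx1
    calc g = g * (C (C (C c⁻¹)) * f * x ()) := by rw [h3, mul_one]
      _ = C (C (C c⁻¹)) * x () * (f * g) := by ring
      _ = _ := by rw [hfg, mul_one]
  rw [hg]
  exact hW.mul_mem (hW.mem_of_const _) hxm

end IsWeightClass

/-! ### Derivations and the subring of series which do not involve `t₁` -/

/-- An additive map applied to all coefficients of a power series. -/
noncomputable def cw {R : Type*} [CommRing R] (d : R →+ R) :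
    PowerSeries R →+ PowerSeries R where
  toFun f := PowerSeries.mk fun k => d (coeff k f)
  map_zero' := by ext; simp
  map_add' f g := by ext; simp

@[simp] theorem coeff_cw {R : Type*} [CommRing R] (d : R →+ R) (k : ℕ) (f : PowerSeries R) :
    coeff k (cw d f) = d (coeff k f) := by simp [cw]

theorem cw_mul {R : Type*} [CommRing R] {d : R →+ R} (hd : ∀ a b, d (a * b) = d a * b + a * d b)
    (f g : PowerSeries R) : cw d (f * g) = cw d f * g + f * cw d g := by
  ext k
  simp only [coeff_cw, coeff_mul, map_sum, map_add, hd, Finset.sum_add_distrib]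

theorem cw_X_mul {R : Type*} [CommRing R] (d : R →+ R) (f : PowerSeries R) :
    cw d (X * f) = X * cw d f := by
  ext (_ | k)
  · simp
  · simp [coeff_succ_X_mul]

/-- The derivation `d / dX` of `R⟦X⟧` as an additive map. -/
noncomputable def derX (R : Type*) [CommRing R] : PowerSeries R →+ PowerSeries R where
  toFun := derivative R
  map_zero' := map_zero _
  map_add' := map_add _

theorem derX_apply {R : Type*} [CommRing R] (f : PowerSeries R) : derX R f = derivative R f := rfl

theorem derX_mul {R : Type*} [CommRing R] (f g : PowerSeries R) :
    derX R (f * g) = derX R f * g + f * derX R g := by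
  simp only [derX_apply, Derivation.leibniz, smul_eq_mul]; ring

/-- `∂ / ∂t₂` on `ℂ⟦t₂⟧`. -/
noncomputable def der : SerT2 →+ SerT2 := derX ℂ

theorem coeff_der (f : SerT2) (n : ℕ) : coeff n (der f) = coeff (n + 1) f * (n + 1) :=
  coeff_derivative f n

theorem der_mul (f g : SerT2) : der (f * g) = der f * g + f * der g := derX_mul f g

@[simp] theorem der_C (c : ℂ) : der (C c) = 0 := derivative_C

/-- `∂ / ∂t₂` on `ℂ⟦t₂, z⟧`. -/
noncomputable def D : SerT2Z →+ SerT2Z := cw der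

theorem D_mul (f g : SerT2Z) : D (f * g) = D f * g + f * D g := cw_mul der_mul f g
theorem D_X_mul (f : SerT2Z) : D (X * f) = X * D f := cw_X_mul der f
@[simp] theorem coeff_D (k : ℕ) (f : SerT2Z) : coeff k (D f) = der (coeff k f) := coeff_cw _ _ _
theorem D_C (c : SerT2) : D (C c) = C (der c) := by
  ext k : 1
  rw [coeff_D, coeff_C, coeff_C]
  split_ifs <;> simp
@[simp] theorem D_const (c : ℂ) : D (C (C c)) = 0 := by rw [D_C]; simp
theorem D_const_mul (c : ℂ) (f : SerT2Z) : D (C (C c) * f) = C (C c) * D f := by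
  rw [D_mul]; simp
@[simp] theorem D_one : D 1 = 0 := by simpa using D_const 1

theorem pd_zero_eq_cw (f : Ser) : pd 0 f = cw (derX SerT2) f := by
  refine PowerSeries.ext fun k => ?_
  simp [pd, derX_apply]

theorem pd_one_eq_cw (f : Ser) : pd 1 f = cw (cw der) f := by
  refine PowerSeries.ext fun k => PowerSeries.ext fun l => ?_
  simp [pd, der, derX_apply]

theorem pd_mul (i : Fin 2) (f g : Ser) : pd i (f * g) = pd i f * g + f * pd i g := by
  fin_cases i
  · simp only [Fin.zero_eta, pd_zero_eq_cw]
    exact cw_mul derX_mul f g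
  · simp only [Fin.mk_one, pd_one_eq_cw]
    exact cw_mul (cw_mul der_mul) f g

theorem pd_zero (i : Fin 2) : pd i 0 = 0 := by
  have := pd_add i 0 0
  simpa using this

theorem pd_sub (i : Fin 2) (f g : Ser) : pd i (f - g) = pd i f - pd i g := by
  have := pd_add i (f - g) g
  rw [sub_add_cancel] at this
  rw [this, add_sub_cancel_right]

theorem pd_const (i : Fin 2) (c : ℂ) : pd i (C (C (C c))) = 0 := by
  ext ⟨k, a, b⟩
  fin_cases i
  · rw [Fin.zero_eta, cft_pd_zero]
    by_cases hk : k = 0 <;> simp [cft, cf, coeff_C, hk]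
  · rw [Fin.mk_one, cft_pd_one]
    by_cases hk : k = 0 <;> by_cases ha : a = 0 <;> simp [cft, cf, coeff_C, hk, ha]

theorem pd_one (i : Fin 2) : pd i 1 = 0 := by simpa using pd_const i 1

theorem pd_z_mul (i : Fin 2) (f : Ser) : pd i (z * f) = z * pd i f := by
  fin_cases i
  · simp only [Fin.zero_eta, pd_zero_eq_cw]
    exact cw_X_mul _ f
  · simp only [Fin.mk_one, pd_one_eq_cw]
    exact cw_X_mul _ f

theorem pd_comm (f : Ser) : pd 0 (pd 1 f) = pd 1 (pd 0 f) := by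
  ext ⟨k, a, b⟩
  simp only [cft_pd_zero, cft_pd_one]
  ring

/-- Restriction to `t₁ = 0`. -/
noncomputable def ev : Ser →+* SerT2Z := PowerSeries.map constantCoeff

/-- The value at `t₂ = z = 0`. -/
noncomputable def orig : SerT2Z →+* ℂ := constantCoeff.comp constantCoeff

theorem orig_ev (f : Ser) : orig (ev f) = cft f (0, 0, 0) := by
  simp [orig, ev, cft, cf, ← coeff_zero_eq_constantCoeff_apply, -coeff_zero_eq_constantCoeff]

@[simp] theorem ev_incl (x : SerT2Z) : ev (incl x) = x := by
  ext; simp [ev, incl]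

theorem ev_pd_one (f : Ser) : ev (pd 1 f) = D (ev f) := by
  ext k : 1
  rw [coeff_D, pd_one_eq_cw, ev, coeff_map, coeff_map, coeff_cw,
    ← coeff_zero_eq_constantCoeff_apply, ← coeff_zero_eq_constantCoeff_apply, coeff_cw]

theorem pd_one_incl (x : SerT2Z) : pd 1 (incl x) = incl (D x) := by
  ext ⟨k, a, b⟩
  rw [cft_pd_one]
  by_cases ha : a = 0 <;> simp [cft, cf, incl, coeff_C, ha, coeff_der]

theorem pd_zero_incl (x : SerT2Z) : pd 0 (incl x) = 0 := by
  ext ⟨k, a, b⟩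
  rw [cft_pd_zero]
  simp [cft, cf, incl]

@[simp] theorem incl_X : incl X = z := by simp [incl, z]
@[simp] theorem ev_z : ev z = X := by simp [ev, z]
theorem incl_const (c : ℂ) : incl (C (C c)) = C (C (C c)) := by simp [incl]

/-- A series with `∂₁ f = 0` does not involve `t₁`. -/
theorem incl_ev_of_pd_zero {f : Ser} (h : pd 0 f = 0) : incl (ev f) = f := by
  ext ⟨k, a, b⟩
  rcases a with _ | a
  · simp [cft, cf, incl, ev]
  · have h1 := cft_pd_zero f k a b
    rw [h, cft_zero] at h1
    have h2 : ((a : ℂ) + 1) ≠ 0 := by exact_mod_cast a.succ_ne_zero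
    have h3 : cft f (k, a + 1, b) = 0 := by
      rcases mul_eq_zero.1 h1.symm with h | h
      · exact h
      · exact absurd h h2
    rw [h3]
    simp [cft, cf, incl]

namespace IsWeightClass

variable {W : Set (ℕ → ℝ≥0∞)}

/-- `conv W` as a subring. -/
def ring (hW : IsWeightClass W) : Subring Ser where
  carrier := conv W
  mul_mem' := hW.mul_mem
  one_mem' := hW.one_mem
  add_mem' := hW.add_mem
  zero_mem' := hW.zero_mem
  neg_mem' := hW.neg_mem

/-- The elements of `conv W` which do not involve `t₁`. -/
noncomputable def ringS (hW : IsWeightClass W) : Subring SerT2Z := hW.ring.comap incl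

theorem mem_ringS (hW : IsWeightClass W) {f : SerT2Z} : f ∈ hW.ringS ↔ incl f ∈ conv W := Iff.rfl

theorem ev_mem (hW : IsWeightClass W) {f : Ser} (hf : f ∈ conv W) : ev f ∈ hW.ringS := by
  refine hW.mem_of_cft hf ?_
  rintro ⟨k, i, j⟩
  rcases i with _ | i
  · exact Or.inl (by simp [cft, cf, incl, ev])
  · exact Or.inr (by simp [cft, cf, incl])

theorem X_mem (hW : IsWeightClass W) : X ∈ hW.ringS := by
  rw [mem_ringS, incl_X]; exact hW.z_mem

theorem const_mem (hW : IsWeightClass W) (c : ℂ) : C (C c) ∈ hW.ringS := by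
  rw [mem_ringS, incl_const]; exact hW.mem_of_const c

theorem D_mem (hW : IsWeightClass W) {f : SerT2Z} (hf : f ∈ hW.ringS) : D f ∈ hW.ringS := by
  rw [mem_ringS, ← pd_one_incl]; exact hW.pd_mem hf 1

theorem inv_mem (hW : IsWeightClass W) {f g : SerT2Z} (hf : f ∈ hW.ringS) (h : f * g = 1) :
    g ∈ hW.ringS :=
  hW.mem_of_mul_eq_one (f := incl f) hf (by rw [← map_mul, h, map_one])

theorem mem_of_X_mul_mem (hW : IsWeightClass W) {f : SerT2Z} (hf : X * f ∈ hW.ringS) :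
    f ∈ hW.ringS :=
  hW.mem_of_z_mul_mem (f := incl f) (by rw [← incl_X, ← map_mul]; exact hf)

theorem coeff_zero_mem (hW : IsWeightClass W) {f : SerT2Z} (hf : f ∈ hW.ringS) :
    C (coeff 0 f) ∈ hW.ringS := by
  refine hW.mem_of_cft hf ?_
  rintro ⟨k, i, j⟩
  rcases k with _ | k
  · exact Or.inl (by simp [cft, cf, incl])
  · exact Or.inr (by simp [cft, cf, incl])

theorem exists_X_mul (hW : IsWeightClass W) {f : SerT2Z} (hf : f ∈ hW.ringS)
    (h0 : coeff 0 f = 0) : ∃ g ∈ hW.ringS, f = X * g := by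
  obtain ⟨g, rfl⟩ := X_dvd_iff.2 (by simpa using h0)
  exact ⟨g, hW.mem_of_X_mul_mem hf, rfl⟩

/-- Linear differential equations in `t₂` without `t₁`: restrict a solution to `t₁ = 0`. -/
theorem exists_ode_D (hW : IsWeightClass W) {ι : Type*} [Fintype ι] (M : ι → ι → SerT2Z)
    (hM : ∀ a b, M a b ∈ hW.ringS) (y : ι → ℂ) :
    ∃ Y : ι → SerT2Z, (∀ a, Y a ∈ hW.ringS) ∧ (∀ a, D (Y a) = ∑ b, M a b * Y b) ∧
      ∀ a, orig (Y a) = y a := by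
  obtain ⟨Y, hY, h⟩ := hW.exists_ode 1 (fun a b => incl (M a b)) hM
    (fun a => C (C (C (y a)))) (fun a => hW.mem_of_const _)
  refine ⟨fun a => ev (Y a), fun a => hW.ev_mem (hY a), fun a => ?_, fun a => ?_⟩
  · rw [← ev_pd_one, h a, pd_add, pd_const, pd_itg, zero_add, map_sum]
    simp
  · beta_reduce
    rw [h a, map_add, map_add]
    rw [orig_ev (itg _ _)]
    simp [itg, orig, ev]

end IsWeightClass

theorem isUnit_iff_orig {f : SerT2Z} : IsUnit f ↔ orig f ≠ 0 := by
  rw [isUnit_iff_constantCoeff, isUnit_iff_constantCoeff, isUnit_iff_ne_zero]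
  rfl

theorem isUnit_iff_orig_ev {f : Ser} : IsUnit f ↔ orig (ev f) ≠ 0 := by
  rw [isUnit_iff_constantCoeff, isUnit_iff_constantCoeff, isUnit_iff_constantCoeff,
    isUnit_iff_ne_zero]
  simp [orig, ev, ← coeff_zero_eq_constantCoeff_apply, -coeff_zero_eq_constantCoeff]

/-! ### Gauge transformations -/

theorem mpd_mul (i : Fin 2) (M N : Mat) : mpd i (M * N) = mpd i M * N + M * mpd i N := by
  ext1 a b
  simp only [mpd, Matrix.map_apply, Matrix.mul_apply, Matrix.add_apply, Fin.sum_univ_two, pd_add,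
    pd_mul]
  ring

theorem mpd_one (i : Fin 2) : mpd i 1 = 0 := by
  ext1 a b
  simp only [mpd, Matrix.map_apply, Matrix.one_apply, Matrix.zero_apply]
  split_ifs
  · exact pd_one i
  · exact pd_zero i

theorem mpd_sub (i : Fin 2) (M N : Mat) : mpd i (M - N) = mpd i M - mpd i N := by
  ext1 a b; exact pd_sub i _ _

theorem mpd_z_smul (i : Fin 2) (M : Mat) : mpd i (z • M) = z • mpd i M := by
  ext1 a b; exact pd_z_mul i _

theorem mpd_comm (M : Mat) : mpd 0 (mpd 1 M) = mpd 1 (mpd 0 M) := by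
  ext1 a b; exact pd_comm _

namespace IsWeightClass

variable {W : Set (ℕ → ℝ≥0∞)}

theorem matrix_mul_mem (hW : IsWeightClass W) {M N : Mat} (hM : ∀ a b, M a b ∈ conv W)
    (hN : ∀ a b, N a b ∈ conv W) (a b) : (M * N) a b ∈ conv W := by
  rw [Matrix.mul_apply]
  exact hW.sum_mem _ _ fun c _ => hW.mul_mem (hM _ _) (hN _ _)

/-- The inverse of a matrix with entries in `conv W` has entries in `conv W`. -/
theorem exists_inverse (hW : IsWeightClass W) {T : Mat} (hT : ∀ a b, T a b ∈ conv W)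
    (hu : IsUnit T) : ∃ S : Mat, (∀ a b, S a b ∈ conv W) ∧ S * T = 1 ∧ T * S = 1 := by
  have hdet : IsUnit T.det := (Matrix.isUnit_iff_isUnit_det T).1 hu
  obtain ⟨d, hd⟩ := isUnit_iff_exists_inv.1 hdet
  have hdm : d ∈ conv W := by
    refine hW.mem_of_mul_eq_one ?_ hd
    rw [Matrix.det_fin_two]
    exact hW.sub_mem (hW.mul_mem (hT _ _) (hT _ _)) (hW.mul_mem (hT _ _) (hT _ _))
  refine ⟨d • T.adjugate, fun a b => ?_, ?_, ?_⟩
  · refine hW.mul_mem hdm ?_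
    rw [Matrix.adjugate_fin_two]
    fin_cases a <;> fin_cases b <;> simp [hT, hW.neg_mem]
  · rw [smul_mul_assoc, Matrix.adjugate_mul, smul_smul, mul_comm d, hd, one_smul]
  · rw [mul_smul_comm, Matrix.mul_adjugate, smul_smul, mul_comm d, hd, one_smul]

theorem gaugeIso_trans (hW : IsWeightClass W) {A B G : Fin 2 → Mat} (h : GaugeIso (conv W) A B)
    (h' : GaugeIso (conv W) B G) : GaugeIso (conv W) A G := by
  obtain ⟨T, hT, hTu, hTe⟩ := h
  obtain ⟨S, hS, hSu, hSe⟩ := h'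
  refine ⟨T * S, hW.matrix_mul_mem hT hS, hTu.mul hSu, fun i => ?_⟩
  calc z • mpd i (T * S) + A i * (T * S) - T * S * G i
      = (z • mpd i T + A i * T - T * B i) * S + T * (z • mpd i S + B i * S - S * G i) := by
        rw [mpd_mul]
        simp only [smul_add, mul_add, add_mul, sub_mul, mul_sub, smul_mul_assoc, mul_smul_comm,
          mul_assoc]
        abel
    _ = 0 := by rw [hTe, hSe, zero_mul, mul_zero, add_zero]

theorem gaugeIso_symm (hW : IsWeightClass W) {A B : Fin 2 → Mat} (h : GaugeIso (conv W) A B) :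
    GaugeIso (conv W) B A := by
  obtain ⟨T, hT, hTu, hTe⟩ := h
  obtain ⟨S, hS, hST, hTS⟩ := hW.exists_inverse hT hTu
  refine ⟨S, hS, ⟨⟨S, T, hST, hTS⟩, rfl⟩, fun i => ?_⟩
  have h1 : mpd i S * T + S * mpd i T = 0 := by rw [← mpd_mul, hST, mpd_one]
  have h2 : mpd i S = -(S * mpd i T * S) := by
    calc mpd i S = (mpd i S * T + S * mpd i T) * S - S * mpd i T * S := by
          rw [add_mul, mul_assoc (mpd i S), hTS, mul_one]; abel
      _ = _ := by rw [h1, zero_mul, zero_sub]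
  calc z • mpd i S + B i * S - S * A i
      = -(S * (z • mpd i T + A i * T - T * B i) * S) + (B i * S - (S * T) * B i * S)
          + (S * A i * (T * S) - S * A i) := by
        rw [h2]
        simp only [smul_neg, mul_add, add_mul, sub_mul, mul_sub, smul_mul_assoc, mul_smul_comm,
          mul_assoc]
        abel
    _ = 0 := by rw [hTe, hST, hTS]; simp

end IsWeightClass

/-- Flatness is preserved by gauge transformations. -/
theorem flat_of_gauge {A B : Fin 2 → Mat} {T : Mat} (hu : IsUnit T)
    (hT : ∀ i, z • mpd i T + A i * T - T * B i = 0)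
    (hA : z • mpd 0 (A 1) - z • mpd 1 (A 0) + (A 0 * A 1 - A 1 * A 0) = 0) :
    z • mpd 0 (B 1) - z • mpd 1 (B 0) + (B 0 * B 1 - B 1 * B 0) = 0 := by
  have e : ∀ i, z • mpd i T = T * B i - A i * T := fun i => by
    rw [← sub_eq_zero, ← hT i]; abel
  have e1 : ∀ i j, z • mpd j (z • mpd i T) = (T * B j - A j * T) * B i + T * (z • mpd j (B i)) -
      ((z • mpd j (A i)) * T + A i * (T * B j - A j * T)) := fun i j => by
    rw [← e j]
    conv_lhs => rw [e i]
    simp only [mpd_sub, mpd_mul, smul_sub, smul_add, smul_mul_assoc, mul_smul_comm]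
  have e2 : z • mpd 0 (z • mpd 1 T) = z • mpd 1 (z • mpd 0 T) := by
    rw [mpd_z_smul, mpd_z_smul, mpd_comm]
  rw [e1, e1] at e2
  have e3 : T * (z • mpd 0 (B 1) - z • mpd 1 (B 0) + (B 0 * B 1 - B 1 * B 0)) =
      (z • mpd 0 (A 1) - z • mpd 1 (A 0) + (A 0 * A 1 - A 1 * A 0)) * T := by
    rw [← sub_eq_zero] at e2 ⊢
    rw [← e2]
    simp only [mul_add, add_mul, sub_mul, mul_sub, mul_assoc]
    abel
  rw [hA, zero_mul] at e3
  exact hu.mul_left_cancel (by rw [e3, mul_zero])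

/-! ### Gauge transformations between the structures `form f` -/

/-- The second matrix of `form f`, over `ℂ⟦t₂, z⟧`. -/
noncomputable def formS (f : SerT2Z) : Matrix (Fin 2) (Fin 2) SerT2Z := !![0, X * f; 1, 0]

theorem form_zero (f : SerT2Z) : form f 0 = 1 := rfl

theorem form_one (f : SerT2Z) : form f 1 = (formS f).map incl := by
  ext1 a b
  fin_cases a <;> fin_cases b <;> simp [form, formS, C₂, E]

theorem mpd_zero_map_incl (P : Matrix (Fin 2) (Fin 2) SerT2Z) : mpd 0 (P.map incl) = 0 := by
  ext1 a b; exact pd_zero_incl _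

theorem mpd_one_map_incl (P : Matrix (Fin 2) (Fin 2) SerT2Z) :
    mpd 1 (P.map incl) = (P.map D).map incl := by
  ext1 a b; exact pd_one_incl _

/-- A gauge transformation over `ℂ⟦t₂, z⟧`. -/
theorem gaugeIso_of_matrix {𝒪 : Set Ser} {N N' P : Matrix (Fin 2) (Fin 2) SerT2Z}
    (hP : ∀ a b, incl (P a b) ∈ 𝒪) (hdet : orig P.det ≠ 0)
    (h : (X : SerT2Z) • P.map D + N * P = P * N') :
    GaugeIso 𝒪 ![1, N.map incl] ![1, N'.map incl] := by
  refine ⟨P.map incl, hP, ?_, fun i => ?_⟩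
  · have h1 : IsUnit P := (Matrix.isUnit_iff_isUnit_det P).2 (isUnit_iff_orig.2 hdet)
    exact h1.map incl.mapMatrix
  · fin_cases i
    · simp [mpd_zero_map_incl]
    · have h1 := congrArg (fun M : Matrix (Fin 2) (Fin 2) SerT2Z => M.map incl) h
      simp only [Matrix.map_mul, Matrix.map_add _ (map_add incl)] at h1
      have h2 : ((X : SerT2Z) • P.map D).map incl = z • (P.map D).map incl := by
        ext1 a b
        simp
      rw [h2] at h1
      change z • mpd 1 (P.map incl) + N.map incl * P.map incl - P.map incl * N'.map incl = 0
      rw [mpd_one_map_incl, h1, sub_self]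

theorem form_eq (f : SerT2Z) : form f = ![1, (formS f).map incl] := by
  rw [← form_one]; rfl

/-- Gauge isomorphic structures `form f` and `form g` are related by two series `a`, `b` satisfying
a linear system of differential equations. -/
theorem exists_of_gaugeIso {𝒪 : Set Ser} {f g : SerT2Z} (h : GaugeIso 𝒪 (form f) (form g)) :
    ∃ a b : SerT2Z, orig a ≠ 0 ∧ 2 * D a + X * D (D b) + f * b = g * b ∧
      X * D (D a) + X * D (f * b) + X * (f * D b) + f * a = g * a := by
  obtain ⟨T, -, hu, hT⟩ := h
  have hev : (X : SerT2Z) • (T.map ev).map D + formS f * T.map ev = T.map ev * formS g := by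
    have h1 := congrArg (fun M : Mat => M.map ev) (hT 1)
    rw [form_one, form_one] at h1
    have h2 : ∀ f : SerT2Z, ((formS f).map incl).map ev = formS f := fun f => by
      ext1 a b; simp
    have h3 : (z • mpd 1 T).map ev = (X : SerT2Z) • (T.map ev).map D := by
      ext1 a b; simp [mpd, ev_pd_one]
    simp only [Matrix.map_sub _ (map_sub ev), Matrix.map_add _ (map_add ev), Matrix.map_mul, h2,
      h3] at h1
    rw [← sub_eq_zero, h1]
    exact Matrix.map_zero _ (map_zero ev)
  have hdet : orig (T.map ev).det ≠ 0 := by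
    have h1 : IsUnit (T.map ev) := hu.map ev.mapMatrix
    exact isUnit_iff_orig.1 ((Matrix.isUnit_iff_isUnit_det _).1 h1)
  set P := T.map ev with hP
  have e := fun a b => congrFun (congrFun hev a) b
  have e00 := e 0 0
  have e01 := e 0 1
  have e10 := e 1 0
  have e11 := e 1 1
  simp only [Matrix.add_apply, Matrix.smul_apply, Matrix.map_apply, Matrix.mul_apply,
    Fin.sum_univ_two, formS, Matrix.of_apply, Matrix.cons_val', Matrix.cons_val_zero,
    Matrix.cons_val_one, Matrix.cons_val_fin_one, smul_eq_mul, zero_mul, mul_zero, one_mul, mul_one,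
    zero_add, add_zero] at e00 e01 e10 e11
  have hD1 : D (P 1 1) = X * D (D (P 1 0)) + D (P 0 0) := by
    rw [← e10, map_add, D_X_mul]
  have hD0 : D (P 0 1) = X * D (D (P 0 0)) + X * D (f * P 1 0) := by
    rw [← e00, map_add, D_X_mul, mul_assoc, D_X_mul]
  refine ⟨P 0 0, P 1 0, ?_, ?_, ?_⟩
  · intro h0
    apply hdet
    rw [Matrix.det_fin_two, ← e00, ← e10]
    simp only [map_sub, map_mul, map_add, h0]
    simp [orig]
  · apply mul_left_cancel₀ (X_ne_zero (R := SerT2))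
    linear_combination e11 + e00 - X * hD1
  · apply mul_left_cancel₀ (X_ne_zero (R := SerT2))
    linear_combination e01 - X * hD0 + X * f * e10

/-- The converse of `exists_of_gaugeIso`. -/
theorem IsWeightClass.gaugeIso_form {W : Set (ℕ → ℝ≥0∞)} (hW : IsWeightClass W)
    {f g a b : SerT2Z} (hf : f ∈ hW.ringS) (ha : a ∈ hW.ringS) (hb : b ∈ hW.ringS)
    (h0 : orig a ≠ 0) (h1 : 2 * D a + X * D (D b) + f * b = g * b)
    (h2 : X * D (D a) + X * D (f * b) + X * (f * D b) + f * a = g * a) :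
    GaugeIso (conv W) (form f) (form g) := by
  rw [form_eq, form_eq]
  have hX := hW.X_mem
  have hc : X * D a + X * f * b ∈ hW.ringS :=
    hW.ringS.add_mem (hW.ringS.mul_mem hX (hW.D_mem ha))
      (hW.ringS.mul_mem (hW.ringS.mul_mem hX hf) hb)
  have hd : X * D b + a ∈ hW.ringS := hW.ringS.add_mem (hW.ringS.mul_mem hX (hW.D_mem hb)) ha
  refine gaugeIso_of_matrix (P := !![a, X * D a + X * f * b; b, X * D b + a]) ?_ ?_ ?_
  · intro i j
    fin_cases i <;> fin_cases j
    exacts [ha, hc, hb, hd]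
  · rw [Matrix.det_fin_two_of]
    simpa [orig] using h0
  · ext1 i j
    fin_cases i <;> fin_cases j <;>
      simp [formS, Matrix.mul_apply, Fin.sum_univ_two, D_X_mul, mul_assoc]
    · linear_combination X * h2
    · linear_combination X * h1

theorem constantCoeff_ne_zero_of_orig {a : SerT2Z} (h : orig a ≠ 0) : constantCoeff a ≠ 0 :=
  fun hc => h (by simp [orig, hc])

@[simp] theorem constantCoeff_D (f : SerT2Z) : constantCoeff (D f) = der (constantCoeff f) := by
  rw [← coeff_zero_eq_constantCoeff_apply, ← coeff_zero_eq_constantCoeff_apply, coeff_D]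

/-- Invariance of `f(0)`. -/
theorem coeff_zero_eq_of_gaugeIso {𝒪 : Set Ser} {f g : SerT2Z}
    (h : GaugeIso 𝒪 (form f) (form g)) : coeff 0 f = coeff 0 g := by
  obtain ⟨a, b, h0, -, h2⟩ := exists_of_gaugeIso h
  have := congrArg constantCoeff h2
  apply mul_right_cancel₀ (constantCoeff_ne_zero_of_orig h0)
  simpa using this

/-- The difference of two gauge isomorphic `f`, `g` is `z h`, where `h` satisfies the equations
obtained from those of `exists_of_gaugeIso` by dividing by `z`. -/
theorem exists_quotient_of_gaugeIso {𝒪 : Set Ser} {f g : SerT2Z}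
    (hg : GaugeIso 𝒪 (form f) (form g)) :
    ∃ a b h : SerT2Z, orig a ≠ 0 ∧ g = f + X * h ∧ 2 * D a = X * (h * b - D (D b)) ∧
      h * a = D (D a) + D f * b + 2 * f * D b := by
  obtain ⟨a, b, h0, h1, h2⟩ := exists_of_gaugeIso hg
  obtain ⟨h, hh⟩ : X ∣ g - f := X_dvd_iff.2 (by
    have := coeff_zero_eq_of_gaugeIso hg
    rw [map_sub, sub_eq_zero]
    simpa using this.symm)
  refine ⟨a, b, h, h0, by rw [← hh]; ring, ?_, ?_⟩
  · linear_combination h1 + b * hh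
  · apply mul_left_cancel₀ (X_ne_zero (R := SerT2))
    rw [D_mul] at h2
    linear_combination -h2 - a * hh

theorem const_inv_two_mul_two : (C (C 2⁻¹) : SerT2Z) * 2 = 1 := by
  have h2 : (2 : SerT2Z) = C (C 2) := by rw [map_ofNat, map_ofNat]
  rw [h2, ← map_mul, ← map_mul]
  simp

/-- Invariance of `f(1)` if `f(0) = 0`. -/
theorem coeff_one_eq_of_gaugeIso {𝒪 : Set Ser} {f g : SerT2Z}
    (hg : GaugeIso 𝒪 (form f) (form g)) (hf : coeff 0 f = 0) : coeff 1 f = coeff 1 g := by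
  obtain ⟨a, b, h, h0, rfl, h1, h2⟩ := exists_quotient_of_gaugeIso hg
  have hDa : D a = X * (C (C 2⁻¹) * (h * b - D (D b))) := by
    linear_combination C (C 2⁻¹) * h1 - D a * const_inv_two_mul_two
  have h3 := congrArg constantCoeff h2
  rw [coeff_zero_eq_constantCoeff_apply] at hf
  rw [hDa, D_X_mul] at h3
  simp only [map_mul, map_add, constantCoeff_X, constantCoeff_D, hf, map_zero, zero_mul, zero_add,
    mul_zero, mul_eq_zero, constantCoeff_ne_zero_of_orig h0, or_false] at h3
  have h4 : coeff 1 (X * h) = constantCoeff h := by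
    rw [← zero_add 1, coeff_succ_X_mul, coeff_zero_eq_constantCoeff_apply]
  rw [map_add, h4, h3, add_zero]

@[simp] theorem D_X : D X = 0 := by
  have := D_X_mul 1
  rwa [mul_one, D_one, mul_zero] at this

namespace IsWeightClass

variable {W : Set (ℕ → ℝ≥0∞)}

/-! ### The normal form if `f(0) = 0` -/

theorem gaugeIso_of_coeff_zero_eq_zero (hW : IsWeightClass W) {f : SerT2Z} (hf : f ∈ hW.ringS)
    (h0 : coeff 0 f = 0) : GaugeIso (conv W) (form f) (form (X * C (coeff 1 f))) := by
  obtain ⟨q, hq, rfl⟩ := hW.exists_X_mul hf h0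
  have hq1 : coeff 1 (X * q) = coeff 0 q := by rw [← zero_add 1, coeff_succ_X_mul]
  rw [hq1]
  obtain ⟨h, hh, hqh⟩ := hW.exists_X_mul (hW.ringS.sub_mem (hW.coeff_zero_mem hq) hq)
    (by simp)
  have hX := hW.X_mem
  have hc := hW.const_mem 2⁻¹
  have h2 : (2 : SerT2Z) ∈ hW.ringS := natCast_mem hW.ringS 2
  -- the unknowns are `a`, `b`, `∂₂ b`, `∂₂² b`
  obtain ⟨Y, hY, hD, hY0⟩ := hW.exists_ode_D (ι := Fin 4)
    ![![0, C (C 2⁻¹) * X * X * h, 0, -(C (C 2⁻¹) * X)], ![0, 0, 1, 0], ![0, 0, 0, 1],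
      ![-(2 * h), X * D h + 2 * D q, X * h + 2 * 2 * q, 0]]
    (by
      intro a b
      have e1 : C (C 2⁻¹) * X * X * h ∈ hW.ringS := by
        exact hW.ringS.mul_mem (hW.ringS.mul_mem (hW.ringS.mul_mem hc hX) hX) hh
      have e2 : -(C (C 2⁻¹) * X) ∈ hW.ringS := hW.ringS.neg_mem (hW.ringS.mul_mem hc hX)
      have e3 : -(2 * h) ∈ hW.ringS := hW.ringS.neg_mem (hW.ringS.mul_mem h2 hh)
      have e4 : X * D h + 2 * D q ∈ hW.ringS :=
        hW.ringS.add_mem (hW.ringS.mul_mem hX (hW.D_mem hh)) (hW.ringS.mul_mem h2 (hW.D_mem hq))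
      have e5 : X * h + 2 * 2 * q ∈ hW.ringS :=
        hW.ringS.add_mem (hW.ringS.mul_mem hX hh) (hW.ringS.mul_mem (hW.ringS.mul_mem h2 h2) hq)
      have e6 := hW.ringS.zero_mem
      have e7 := hW.ringS.one_mem
      fin_cases a <;> fin_cases b
      exacts [e6, e1, e6, e2, e6, e6, e7, e6, e6, e6, e6, e7, e3, e4, e5, e6])
    ![1, 0, 0, 0]
  have d0 := hD 0
  have d1 := hD 1
  have d2 := hD 2
  have d3 := hD 3
  simp [Fin.sum_univ_four] at d0 d1 d2 d3
  have dd0 := congrArg D d0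
  simp only [map_add, map_neg, mul_assoc, D_const_mul, D_X_mul, D_mul h, d1] at dd0
  have c2 := const_inv_two_mul_two
  refine hW.gaugeIso_form hf (hY 0) (hY 1) ?_ ?_ ?_
  · rw [hY0]; simp
  · rw [d1, d2]
    linear_combination 2 * d0 + (X * X * h * Y 1 - X * Y 3) * c2 - X * Y 1 * hqh
  · rw [D_mul, D_X_mul, d1, dd0, d3]
    linear_combination (X * X * (h * Y 0 - D q * Y 1 - 2 * q * Y 2)) * c2 - X * Y 0 * hqh

/-! ### Reduction to the form `C₂ + z f E` -/

/-- Let `N` be nilpotent and non-zero at `z = 0`. A vector `u` such that `u`, `N u` is a frame is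
cyclic for `z ∂₂ + N`; after rescaling `u` by the solution `g` of a scalar equation, the coefficient
of the first order term of the corresponding second order equation vanishes. -/
theorem exists_form_of_nilpotent (hW : IsWeightClass W) {N : Matrix (Fin 2) (Fin 2) SerT2Z}
    (hN : ∀ a b, N a b ∈ hW.ringS) (hnil : ∀ a b, constantCoeff ((N * N) a b) = 0)
    (hne : ∃ a b, orig (N a b) ≠ 0) :
    ∃ f ∈ hW.ringS, GaugeIso (conv W) ![1, N.map incl] (form f) := by
  have hnil' : ∀ a b, orig ((N * N) a b) = 0 := fun a b => by
    have := hnil a b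
    simp [orig, this]
  -- a constant vector `u` such that `u`, `N u` is a frame at the origin
  obtain ⟨p, q, hpq⟩ : ∃ p q : ℂ, p * (orig (N 1 0) * p + orig (N 1 1) * q) -
      q * (orig (N 0 0) * p + orig (N 0 1) * q) ≠ 0 := by
    by_contra! hcon
    have c1 := hcon 1 0
    have c2 := hcon 0 1
    have n00 := hnil' 0 0
    have n11 := hnil' 1 1
    simp only [Matrix.mul_apply, Fin.sum_univ_two, map_add, map_mul] at n00 n11
    simp at c1 c2
    rw [c1] at n00 n11
    rw [c2] at n00 n11
    simp at n00 n11
    obtain ⟨a, b, h⟩ := hne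
    fin_cases a <;> fin_cases b <;> simp_all
  set u₀ : SerT2Z := C (C p) with hu₀
  set u₁ : SerT2Z := C (C q) with hu₁
  set v₀ := N 0 0 * u₀ + N 0 1 * u₁ with hv₀
  set v₁ := N 1 0 * u₀ + N 1 1 * u₁ with hv₁
  set w₀ := X * D v₀ + (N 0 0 * v₀ + N 0 1 * v₁) with hw₀
  set w₁ := X * D v₁ + (N 1 0 * v₀ + N 1 1 * v₁) with hw₁
  have mu₀ : u₀ ∈ hW.ringS := hW.const_mem p
  have mu₁ : u₁ ∈ hW.ringS := hW.const_mem q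
  have mv₀ : v₀ ∈ hW.ringS :=
    hW.ringS.add_mem (hW.ringS.mul_mem (hN _ _) mu₀) (hW.ringS.mul_mem (hN _ _) mu₁)
  have mv₁ : v₁ ∈ hW.ringS :=
    hW.ringS.add_mem (hW.ringS.mul_mem (hN _ _) mu₀) (hW.ringS.mul_mem (hN _ _) mu₁)
  have mw₀ : w₀ ∈ hW.ringS := hW.ringS.add_mem (hW.ringS.mul_mem hW.X_mem (hW.D_mem mv₀))
    (hW.ringS.add_mem (hW.ringS.mul_mem (hN _ _) mv₀) (hW.ringS.mul_mem (hN _ _) mv₁))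
  have mw₁ : w₁ ∈ hW.ringS := hW.ringS.add_mem (hW.ringS.mul_mem hW.X_mem (hW.D_mem mv₁))
    (hW.ringS.add_mem (hW.ringS.mul_mem (hN _ _) mv₀) (hW.ringS.mul_mem (hN _ _) mv₁))
  have cw₀ : constantCoeff w₀ = 0 := by
    have h1 := hnil 0 0
    have h2 := hnil 0 1
    simp only [Matrix.mul_apply, Fin.sum_univ_two, map_add, map_mul] at h1 h2
    simp only [hw₀, hv₀, hv₁, map_add, map_mul, constantCoeff_X, zero_mul, zero_add]
    linear_combination constantCoeff u₀ * h1 + constantCoeff u₁ * h2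
  have cw₁ : constantCoeff w₁ = 0 := by
    have h1 := hnil 1 0
    have h2 := hnil 1 1
    simp only [Matrix.mul_apply, Fin.sum_univ_two, map_add, map_mul] at h1 h2
    simp only [hw₁, hv₀, hv₁, map_add, map_mul, constantCoeff_X, zero_mul, zero_add]
    linear_combination constantCoeff u₀ * h1 + constantCoeff u₁ * h2
  have hδ : orig (u₀ * v₁ - u₁ * v₀) ≠ 0 := by
    have : ∀ c : ℂ, orig (C (C c)) = c := fun c => by simp [orig]
    simpa only [hv₀, hv₁, hu₀, hu₁, map_sub, map_mul, map_add, this] using hpq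
  obtain ⟨δ, hδ1⟩ := isUnit_iff_exists_inv.1 (isUnit_iff_orig.2 hδ)
  have mδ : δ ∈ hW.ringS := hW.inv_mem (hW.ringS.sub_mem (hW.ringS.mul_mem mu₀ mv₁)
    (hW.ringS.mul_mem mu₁ mv₀)) hδ1
  -- the second order equation `w = z (α u + β v)`
  obtain ⟨α, mα, hα⟩ := hW.exists_X_mul (f := (w₀ * v₁ - w₁ * v₀) * δ)
    (hW.ringS.mul_mem (hW.ringS.sub_mem (hW.ringS.mul_mem mw₀ mv₁)
      (hW.ringS.mul_mem mw₁ mv₀)) mδ) (by simp [cw₀, cw₁])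
  obtain ⟨β, mβ, hβ⟩ := hW.exists_X_mul (f := (u₀ * w₁ - u₁ * w₀) * δ)
    (hW.ringS.mul_mem (hW.ringS.sub_mem (hW.ringS.mul_mem mu₀ mw₁)
      (hW.ringS.mul_mem mu₁ mw₀)) mδ) (by simp [cw₀, cw₁])
  have e₀ : w₀ = X * (α * u₀ + β * v₀) := by
    linear_combination u₀ * hα + v₀ * hβ - w₀ * hδ1
  have e₁ : w₁ = X * (α * u₁ + β * v₁) := by
    linear_combination u₁ * hα + v₁ * hβ - w₁ * hδ1
  obtain ⟨Y, hY, hD, hY0⟩ := hW.exists_ode_D (ι := Unit) (fun _ _ => -(C (C 2⁻¹) * β))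
    (fun _ _ => hW.ringS.neg_mem (hW.ringS.mul_mem (hW.const_mem _) mβ)) (fun _ => 1)
  set g := Y () with hg
  have mg : g ∈ hW.ringS := hY ()
  have hDg : 2 * D g = -(β * g) := by
    have h1 := hD ()
    simp only [Finset.univ_unique, Finset.sum_singleton] at h1
    have h2 : D g = -(C (C 2⁻¹) * β) * g := h1
    linear_combination 2 * h2 - β * g * const_inv_two_mul_two
  have hg0 : orig g ≠ 0 := by rw [hg, hY0]; exact one_ne_zero
  obtain ⟨γ, hγ⟩ := isUnit_iff_exists_inv.1 (isUnit_iff_orig.2 hg0)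
  have mγ := hW.inv_mem mg hγ
  have Du₀ : D u₀ = 0 := D_const p
  have Du₁ : D u₁ = 0 := D_const q
  refine ⟨(X * D (D g) + g * α) * γ, hW.ringS.mul_mem (hW.ringS.add_mem (hW.ringS.mul_mem hW.X_mem
    (hW.D_mem (hW.D_mem mg))) (hW.ringS.mul_mem mg mα)) mγ, ?_⟩
  rw [form_eq]
  refine gaugeIso_of_matrix
    (P := !![g * u₀, X * D g * u₀ + g * v₀; g * u₁, X * D g * u₁ + g * v₁]) ?_ ?_ ?_
  · have m1 : ∀ x ∈ hW.ringS, g * x ∈ hW.ringS := fun x hx => hW.ringS.mul_mem mg hx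
    have m2 : ∀ x ∈ hW.ringS, X * D g * x ∈ hW.ringS := fun x hx =>
      hW.ringS.mul_mem (hW.ringS.mul_mem hW.X_mem (hW.D_mem mg)) hx
    intro i j
    fin_cases i <;> fin_cases j
    exacts [m1 _ mu₀, hW.ringS.add_mem (m2 _ mu₀) (m1 _ mv₀), m1 _ mu₁,
      hW.ringS.add_mem (m2 _ mu₁) (m1 _ mv₁)]
  · have : (!![g * u₀, X * D g * u₀ + g * v₀; g * u₁, X * D g * u₁ + g * v₁]).det =
        g * g * (u₀ * v₁ - u₁ * v₀) := by rw [Matrix.det_fin_two_of]; ring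
    rw [this, map_mul, map_mul]
    exact mul_ne_zero (mul_ne_zero hg0 hg0) hδ
  · ext1 i j
    fin_cases i <;> fin_cases j <;>
      simp only [formS, Matrix.add_apply, Matrix.smul_apply, Matrix.map_apply, Matrix.mul_apply,
        Fin.sum_univ_two, Matrix.of_apply, Matrix.cons_val', Matrix.cons_val_zero,
        Matrix.cons_val_one, Matrix.cons_val_fin_one, smul_eq_mul, map_add, D_mul, D_X, Du₀, Du₁,
        Fin.zero_eta, Fin.mk_one, mul_assoc, mul_zero, zero_mul, add_zero, mul_one, zero_add]
    · linear_combination -g * hv₀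
    · linear_combination g * e₀ - g * hw₀ - X * D g * hv₀ + X * v₀ * hDg -
        X * u₀ * (X * D (D g) + g * α) * hγ
    · linear_combination -g * hv₁
    · linear_combination g * e₁ - g * hw₁ - X * D g * hv₁ + X * v₁ * hDg -
        X * u₁ * (X * D (D g) + g * α) * hγ

/-- `form f` is a (T)-structure over `𝒩₂`. -/
theorem isTStructureN2_form (hW : IsWeightClass W) {f : SerT2Z} (hf : f ∈ hW.ringS) :
    IsTStructureN2 (conv W) (form f) := by
  have hd : mpd 0 (form f 1) = 0 := by rw [form_one, mpd_zero_map_incl]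
  have hd' : mpd 1 (form f 0) = 0 := by rw [form_zero, mpd_one]
  refine ⟨⟨fun i => ?_, fun i j => ?_⟩, ![1, 0], ?_, ?_, ?_⟩
  · fin_cases i
    · intro a b
      change (1 : Mat) a b ∈ conv W
      rw [Matrix.one_apply]
      split_ifs
      exacts [hW.one_mem, hW.zero_mem]
    · intro a b
      change form f 1 a b ∈ conv W
      rw [form_one]
      fin_cases a <;> fin_cases b
      exacts [hW.ringS.zero_mem, hW.ringS.mul_mem hW.X_mem hf, hW.ringS.one_mem, hW.ringS.zero_mem]
  · fin_cases i <;> fin_cases j <;> simp only [Fin.zero_eta, Fin.mk_one, hd, hd', sub_self] <;>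
      simp [form_zero]
  · intro a
    rw [holomorphicSeries_eq]
    fin_cases a
    · simpa using isWeightClass_geomWeights.one_mem
    · simpa using isWeightClass_geomWeights.zero_mem
  · have : (Matrix.of fun a i => (higgs (form f) i).mulVec ![1, 0] a) = 1 := by
      ext1 a i
      fin_cases a <;> fin_cases i <;> simp [higgs, form, C₁, C₂, E, z]
    rw [this]
    exact isUnit_one
  · intro i j
    funext a
    fin_cases i <;> fin_cases j <;> fin_cases a <;>
      simp [higgs, form, C₁, C₂, E, z, n2mul]

end IsWeightClass

theorem map_coeff_zero (M : Mat) : M.map (coeff 0) = M.map (constantCoeff (R := SerT)) := by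
  ext1 a b
  exact coeff_zero_eq_constantCoeff_apply _

/-- In a (T)-structure over `𝒩₂`, the Higgs field of the unit field is the identity, and that of
`∂₂` is nilpotent and non-zero at the origin. -/
theorem higgs_of_inducesN2 {A : Fin 2 → Mat} (h : InducesN2 A) :
    higgs A 0 = 1 ∧ higgs A 1 * higgs A 1 = 0 ∧
      ∃ a b, constantCoeff (constantCoeff (higgs A 1 a b)) ≠ 0 := by
  obtain ⟨ζ, -, hu, hm⟩ := h
  set P : Matrix (Fin 2) (Fin 2) SerT := Matrix.of fun a i => (higgs A i).mulVec ζ a with hP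
  have hcol : ∀ (M : Matrix (Fin 2) (Fin 2) SerT) a i,
      (M * P) a i = M.mulVec ((higgs A i).mulVec ζ) a := fun M a i => rfl
  have h0 : higgs A 0 = 1 := by
    refine hu.mul_right_cancel ?_
    rw [one_mul]
    ext1 a i
    rw [hcol, ← hm 0 i]
    fin_cases i <;> fin_cases a <;> simp [n2mul, hP]
  have h11 : (higgs A 1).mulVec ((higgs A 1).mulVec ζ) = 0 := by
    rw [← hm 1 1]
    simp [n2mul]
  refine ⟨h0, ?_, ?_⟩
  · refine hu.mul_right_cancel ?_
    rw [zero_mul]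
    ext1 a i
    rw [hcol]
    fin_cases i
    · change ((higgs A 1 * higgs A 1).mulVec ((higgs A 0).mulVec ζ)) a = 0
      rw [h0, Matrix.one_mulVec, ← Matrix.mulVec_mulVec, h11]
      rfl
    · change ((higgs A 1 * higgs A 1).mulVec ((higgs A 1).mulVec ζ)) a = 0
      rw [← Matrix.mulVec_mulVec, h11, Matrix.mulVec_zero]
      rfl
  · by_contra! hc
    have hdet := ((Matrix.isUnit_iff_isUnit_det P).1 hu).map
      ((constantCoeff (R := ℂ)).comp (constantCoeff (R := SerT2)))
    rw [Matrix.det_fin_two] at hdet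
    have hP1 : ∀ a, constantCoeff (constantCoeff (P a 1)) = 0 := fun a => by
      have : P a 1 = higgs A 1 a 0 * ζ 0 + higgs A 1 a 1 * ζ 1 := by
        simp [hP, Matrix.mulVec, dotProduct, Fin.sum_univ_two]
      rw [this]
      simp only [map_add, map_mul, hc, zero_mul, add_zero]
    simp only [RingHom.coe_comp, Function.comp_apply, map_sub, map_mul, hP1, mul_zero, zero_mul,
      sub_zero, isUnit_zero_iff, zero_ne_one] at hdet

namespace IsWeightClass

variable {W : Set (ℕ → ℝ≥0∞)}

/-- A gauge transformation to `A₁ = 1`, obtained by solving `∂₁ T = -B T` where `A₁ = 1 + z B`. -/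
theorem exists_gauge_unit (hW : IsWeightClass W) {A₁ : Mat} (hA : ∀ a b, A₁ a b ∈ conv W)
    (h0 : A₁.map (coeff 0) = 1) :
    ∃ T : Mat, (∀ a b, T a b ∈ conv W) ∧ IsUnit T ∧ z • mpd 0 T + A₁ * T - T = 0 := by
  have hdvd : ∀ a b, ∃ B, B ∈ conv W ∧ A₁ a b = (1 : Mat) a b + z * B := fun a b => by
    have h1 : coeff 0 (A₁ a b) = (1 : Matrix (Fin 2) (Fin 2) SerT) a b :=
      congrFun (congrFun h0 a) b
    obtain ⟨B, hB⟩ : X ∣ A₁ a b - (1 : Mat) a b := X_dvd_iff.2 (by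
      rw [map_sub, ← coeff_zero_eq_constantCoeff_apply, h1]
      simp only [Matrix.one_apply]
      split_ifs <;> simp)
    refine ⟨B, hW.mem_of_z_mul_mem ?_, by rw [z, ← hB]; ring⟩
    rw [z, ← hB]
    refine hW.sub_mem (hA a b) ?_
    rw [Matrix.one_apply]
    split_ifs
    exacts [hW.one_mem, hW.zero_mem]
  choose B hB hAB using hdvd
  have hcol : ∀ c : Fin 2, ∃ Y : Fin 2 → Ser, (∀ a, Y a ∈ conv W) ∧
      ∀ a, Y a = C (C (C (if a = c then 1 else 0))) + itg 0 (∑ b, -B a b * Y b) := fun c =>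
    hW.exists_ode 0 (fun a b => -B a b) (fun a b => hW.neg_mem (hB a b)) _
      (fun a => hW.mem_of_const _)
  choose Y hY hYe using hcol
  refine ⟨Matrix.of fun a c => Y c a, fun a c => hY c a, ?_, ?_⟩
  · have ho : ∀ c a, orig (ev (Y c a)) = if a = c then 1 else 0 := fun c a => by
      rw [hYe c a, map_add, map_add, orig_ev, orig_ev]
      have h1 : cft (itg 0 (∑ b, -B a b * Y c b)) (0, 0, 0) = 0 := by simp [itg]
      rw [h1, add_zero]
      simp [cft, cf]
    rw [Matrix.isUnit_iff_isUnit_det, isUnit_iff_orig_ev, Matrix.det_fin_two]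
    simp [ho]
  · ext1 a c
    have h1 : pd 0 (Y c a) = ∑ b, -B a b * Y c b := by
      conv_lhs => rw [hYe c a, pd_add, pd_const, pd_itg, zero_add]
    simp only [mpd, Matrix.sub_apply, Matrix.add_apply, Matrix.smul_apply, Matrix.map_apply,
      Matrix.of_apply, Matrix.mul_apply, h1, hAB, smul_eq_mul, Matrix.zero_apply, add_mul,
      Finset.sum_add_distrib, Matrix.one_apply, ite_mul, one_mul, zero_mul, Finset.sum_ite_eq,
      Finset.mem_univ, if_true, neg_mul, Finset.sum_neg_distrib, mul_neg, mul_assoc,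
      ← Finset.mul_sum]
    ring

/-- After a gauge transformation, `A₁ = 1` and `A₂` does not involve `t₁`; the restriction of `A₂`
to `z = 0` remains conjugate to the Higgs field of `∂₂`. -/
theorem exists_gaugeIso_unit (hW : IsWeightClass W) {A : Fin 2 → Mat}
    (hA : IsTStructure (conv W) A) (h0 : higgs A 0 = 1) :
    ∃ (N : Matrix (Fin 2) (Fin 2) SerT2Z) (T₀ : Matrix (Fin 2) (Fin 2) SerT),
      (∀ a b, N a b ∈ hW.ringS) ∧ GaugeIso (conv W) A ![1, N.map incl] ∧ IsUnit T₀ ∧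
      T₀ * (N.map incl).map (constantCoeff (R := SerT)) = higgs A 1 * T₀ := by
  obtain ⟨hmem, hflat⟩ := hA
  obtain ⟨T, hT, hu, hTe⟩ := hW.exists_gauge_unit (hmem 0) h0
  obtain ⟨S, hS, hST, hTS⟩ := hW.exists_inverse hT hu
  obtain ⟨M, hM⟩ : ∃ M : Mat, M = S * (z • mpd 1 T + A 1 * T) := ⟨_, rfl⟩
  have hMmem : ∀ a b, M a b ∈ conv W := by
    rw [hM]
    exact hW.matrix_mul_mem hS fun a b => hW.add_mem
      (hW.mul_mem hW.z_mem (hW.pd_mem (hT a b) 1)) (hW.matrix_mul_mem (hmem 1) hT a b)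
  have hTM : T * M = z • mpd 1 T + A 1 * T := by rw [hM, ← mul_assoc, hTS, one_mul]
  have hgauge : ∀ i, z • mpd i T + A i * T - T * (![1, M] : Fin 2 → Mat) i = 0 := by
    rw [Fin.forall_fin_two]
    refine ⟨?_, ?_⟩
    · rw [Matrix.cons_val_zero, mul_one]
      exact hTe
    · rw [Matrix.cons_val_one, Matrix.cons_val_fin_one, hTM, sub_self]
  -- flatness shows that the second matrix does not involve `t₁`
  have hpd : mpd 0 M = 0 := by
    have h1 := flat_of_gauge hu hgauge (hflat 0 1)
    rw [Matrix.cons_val_one, Matrix.cons_val_fin_one, Matrix.cons_val_zero, mpd_one, smul_zero,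
      sub_zero, one_mul, mul_one, sub_self, add_zero] at h1
    ext1 a b
    have h3 : z * mpd 0 M a b = 0 := congrFun (congrFun h1 a) b
    exact (mul_eq_zero.1 h3).resolve_left X_ne_zero
  have hMN : (M.map ev).map incl = M := by
    ext1 a b
    exact incl_ev_of_pd_zero (congrFun (congrFun hpd a) b)
  refine ⟨M.map ev, T.map (constantCoeff (R := SerT)), fun a b => hW.ev_mem (hMmem a b), ?_,
    hu.map (constantCoeff (R := SerT)).mapMatrix, ?_⟩
  · rw [hMN]
    exact ⟨T, hT, hu, hgauge⟩
  · rw [hMN, ← Matrix.map_mul, hTM, Matrix.map_add _ (map_add (constantCoeff (R := SerT))),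
      Matrix.map_mul, higgs, map_coeff_zero]
    have h2 : (z • mpd 1 T).map (constantCoeff (R := SerT)) = 0 := by
      ext1 a b
      simp [z]
    rw [h2, zero_add]

theorem constantCoeff_incl (x : SerT2Z) : constantCoeff (incl x) = C (constantCoeff x) := by
  rw [← coeff_zero_eq_constantCoeff_apply, incl, coeff_map, coeff_zero_eq_constantCoeff_apply]

/-- Every (T)-structure over `𝒩₂` is gauge isomorphic to some `form f`. -/
theorem exists_gaugeIso_form (hW : IsWeightClass W) {A : Fin 2 → Mat}
    (hA : IsTStructureN2 (conv W) A) :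
    ∃ f ∈ hW.ringS, GaugeIso (conv W) A (form f) := by
  obtain ⟨h0, hnil, hne⟩ := higgs_of_inducesN2 hA.2
  obtain ⟨N, T₀, hN, hgi, hu, hconj⟩ := hW.exists_gaugeIso_unit hA.1 h0
  have hmap : (N.map incl).map (constantCoeff (R := SerT)) =
      (N.map (constantCoeff (R := SerT2))).map C := by
    ext1 a b
    exact constantCoeff_incl _
  rw [hmap] at hconj
  have hnil' : (N * N).map (constantCoeff (R := SerT2)) = 0 := by
    have h1 : ((N * N).map (constantCoeff (R := SerT2))).map (C (R := SerT2)) = 0 := by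
      refine hu.mul_left_cancel ?_
      rw [Matrix.map_mul, Matrix.map_mul, ← mul_assoc, hconj, mul_assoc, hconj, ← mul_assoc, hnil,
        zero_mul, mul_zero]
    ext1 a b
    refine C_injective ?_
    rw [Matrix.zero_apply, map_zero]
    exact congrFun (congrFun h1 a) b
  obtain ⟨f, hf, hgf⟩ := hW.exists_form_of_nilpotent hN
    (fun a b => congrFun (congrFun hnil' a) b) (by
      by_contra! hc
      let ε : SerT →+* ℂ := (constantCoeff (R := ℂ)).comp (constantCoeff (R := SerT2))
      have h3 : ((N.map (constantCoeff (R := SerT2))).map C).map ε = 0 := by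
        ext1 a b
        exact hc a b
      have h4 := congrArg (fun N : Matrix (Fin 2) (Fin 2) SerT => N.map ε) hconj
      simp only [Matrix.map_mul, h3, mul_zero] at h4
      have h5 : (higgs A 1).map ε = 0 := by
        refine (hu.map ε.mapMatrix).mul_right_cancel ?_
        rw [zero_mul]
        exact h4.symm
      obtain ⟨a, b, hab⟩ := hne
      exact hab (congrFun (congrFun h5 a) b))
  exact ⟨f, hf, hW.gaugeIso_trans hgi hgf⟩

end IsWeightClass

/-! ### Uniqueness of the formal normal form -/

theorem coeff_mul_of_X_pow_dvd {R : Type*} [CommRing R] {m : ℕ} {b : PowerSeries R}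
    (hb : X ^ m ∣ b) (u : PowerSeries R) : coeff m (u * b) = coeff 0 u * coeff m b := by
  obtain ⟨c, rfl⟩ := hb
  have h : u * (X ^ m * c) = X ^ m * (u * c) := by ring
  have h1 := coeff_X_pow_mul (u * c) m 0
  have h2 := coeff_X_pow_mul c m 0
  rw [zero_add] at h1 h2
  rw [h, h1, h2]
  simp

theorem coeff_X_mul_der (m : ℕ) (b : SerT2) : coeff m (X * der b) = m * coeff m b := by
  rcases m with _ | m
  · simp
  · rw [coeff_succ_X_mul, coeff_der]
    push_cast
    ring

theorem der_X_pow_succ_mul (r : ℕ) (u : SerT2) :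
    der (X ^ (r + 1) * u) = X ^ r * (((r + 1 : ℕ) : SerT2) * u + X * der u) := by
  have h : der (X ^ (r + 1)) = ((r + 1 : ℕ) : SerT2) * X ^ r := by
    simp [der, derX_apply]
  rw [der_mul, h, pow_succ]
  ring

/-- The operator `b ↦ 2 f₀ b' + f₀' b`, for `f₀` of order `r + 1`, is injective, and its image meets
the polynomials of degree `< r` only in `0`. -/
theorem eq_zero_of_solution {r : ℕ} {u b P : SerT2} (hu : constantCoeff u ≠ 0)
    (hP : ∀ j, r ≤ j → coeff j P = 0)
    (h : P = der (X ^ (r + 1) * u) * b + 2 * (X ^ (r + 1) * u) * der b) : P = 0 ∧ b = 0 := by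
  have h1 : P = X ^ r * ((((r + 1 : ℕ) : SerT2) * u + X * der u) * b + 2 * u * (X * der b)) := by
    rw [h, der_X_pow_succ_mul, pow_succ]
    ring
  have hP0 : P = 0 := by
    ext j
    rcases lt_or_ge j r with hj | hj
    · exact X_pow_dvd_iff.1 ⟨_, h1⟩ j hj
    · exact hP j hj
  refine ⟨hP0, ?_⟩
  rw [hP0] at h1
  have h2 := (mul_eq_zero.1 h1.symm).resolve_left (pow_ne_zero r X_ne_zero)
  have key : ∀ m, X ^ m ∣ b := by
    intro m
    induction m with
    | zero => simp
    | succ m ih =>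
      have hXb : X ^ m ∣ X * der b := X_pow_dvd_iff.2 fun j hj => by
        rw [coeff_X_mul_der, X_pow_dvd_iff.1 ih j hj, mul_zero]
      have h3 := congrArg (coeff m) h2
      rw [map_add, coeff_mul_of_X_pow_dvd ih, coeff_mul_of_X_pow_dvd hXb, coeff_X_mul_der] at h3
      simp only [coeff_zero_eq_constantCoeff, map_add, map_mul, map_natCast, constantCoeff_X,
        zero_mul, add_zero, map_ofNat, map_zero] at h3
      have h4 : (((r + 1 + 2 * m : ℕ) : ℂ) * constantCoeff u) * coeff m b = 0 := by
        push_cast at h3 ⊢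
        linear_combination h3
      have h5 : ((r + 1 + 2 * m : ℕ) : ℂ) ≠ 0 := Nat.cast_ne_zero.2 (by omega)
      have h6 := (mul_eq_zero.1 h4).resolve_left (mul_ne_zero h5 hu)
      refine X_pow_dvd_iff.2 fun j hj => ?_
      rcases Nat.lt_succ_iff_lt_or_eq.1 hj with hj | rfl
      · exact X_pow_dvd_iff.1 ih j hj
      · exact h6
  ext j
  exact X_pow_dvd_iff.1 (key (j + 1)) j (Nat.lt_succ_self j)

theorem exists_eq_X_pow_mul {f : SerT2} {r : ℕ} (h : f.order = r) :
    ∃ u : SerT2, constantCoeff u ≠ 0 ∧ f = X ^ r * u := by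
  obtain ⟨h1, h2⟩ := order_eq_nat.1 h
  obtain ⟨u, rfl⟩ := X_pow_dvd_iff.2 h2
  refine ⟨u, ?_, rfl⟩
  have h3 := coeff_X_pow_mul u r 0
  rw [zero_add] at h3
  rwa [h3, coeff_zero_eq_constantCoeff_apply] at h1

/-- Formally gauge isomorphic normal forms agree. -/
theorem IsFormalNormalForm.eq_of_gaugeIso {𝒪 : Set Ser} {r s : ℕ} {F G : SerT2Z}
    (hF : IsFormalNormalForm r F) (hG : IsFormalNormalForm s G)
    (hg : GaugeIso 𝒪 (form F) (form G)) : F = G := by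
  have h0 := coeff_zero_eq_of_gaugeIso hg
  obtain rfl : r = s := by
    have := hF.order_eq
    rw [h0, hG.order_eq] at this
    exact_mod_cast this.symm
  rcases le_or_gt r 1 with hr | hr
  · rw [hF.low hr, hG.low hr, h0]
  obtain ⟨r, rfl⟩ : ∃ q, r = q + 1 := ⟨r - 1, by omega⟩
  obtain ⟨a, b, h, ha, hGF, h1, h2⟩ := exists_quotient_of_gaugeIso hg
  obtain ⟨u, hu, hfu⟩ := exists_eq_X_pow_mul hF.order_eq
  have hpoly : ∀ {H : SerT2Z}, IsFormalNormalForm (r + 1) H → ∀ k j, r ≤ j →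
      coeff j (coeff (k + 1) H) = 0 := by
    intro H hH k j hj
    obtain ⟨p, hp, hpe⟩ := hH.high hr (k + 1) (by omega)
    rw [hpe, Polynomial.coeff_coe]
    exact Polynomial.coeff_eq_zero_of_natDegree_lt (by omega)
  have hh : ∀ k j, r ≤ j → coeff j (coeff k h) = 0 := fun k j hj => by
    have : coeff k h = coeff (k + 1) G - coeff (k + 1) F := by
      rw [hGF, map_add, coeff_succ_X_mul, add_sub_cancel_left]
    rw [this, map_sub, hpoly hG k j hj, hpoly hF k j hj, sub_zero]
  have h20 : (2 : SerT2) ≠ 0 := by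
    rw [← map_ofNat C 2]
    exact (map_ne_zero_iff _ C_injective).2 two_ne_zero
  have two_D : ∀ k, coeff k (2 * D a) = 2 * der (coeff k a) := fun k => by
    rw [two_mul, map_add, coeff_D, two_mul]
  -- the term of order zero of `a` is a non-zero constant
  have ha0 : ∃ c : ℂ, c ≠ 0 ∧ coeff 0 a = C c := by
    have h3 : der (coeff 0 a) = 0 := by
      have h4 := congrArg (coeff 0) h1
      rw [two_D, coeff_zero_X_mul] at h4
      exact (mul_eq_zero.1 h4).resolve_left h20
    refine ⟨orig a, ha, PowerSeries.ext fun n => ?_⟩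
    rcases n with _ | n
    · simp [orig]
    · have h4 := congrArg (coeff n) h3
      rw [coeff_der, map_zero] at h4
      have h5 : ((n : ℂ) + 1) ≠ 0 := by exact_mod_cast n.succ_ne_zero
      rw [(mul_eq_zero.1 h4).resolve_right h5, coeff_C, if_neg n.succ_ne_zero]
  obtain ⟨c, hc, hac⟩ := ha0
  have key : ∀ k, X ^ k ∣ h ∧ X ^ k ∣ b := by
    intro k
    induction k with
    | zero => simp
    | succ k ih =>
      obtain ⟨ihh, ihb⟩ := ih
      have hD : ∀ x : SerT2Z, X ^ k ∣ x → X ^ k ∣ D x := fun x hx =>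
        X_pow_dvd_iff.2 fun j hj => by rw [coeff_D, X_pow_dvd_iff.1 hx j hj, map_zero]
      have hak : der (coeff k a) = 0 := by
        have h4 := congrArg (coeff k) h1
        have h5 : X ^ (k + 1) ∣ X * (h * b - D (D b)) := by
          rw [pow_succ']
          exact mul_dvd_mul_left _ (dvd_sub (Dvd.dvd.mul_left ihb _) (hD _ (hD _ ihb)))
        rw [two_D, X_pow_dvd_iff.1 h5 k (Nat.lt_succ_self k)] at h4
        exact (mul_eq_zero.1 h4).resolve_left h20
      have h3 := congrArg (coeff k) h2
      have hs : coeff 0 (2 * F) = 2 * coeff 0 F := by rw [two_mul, map_add, two_mul]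
      rw [mul_comm h a, map_add, map_add, coeff_mul_of_X_pow_dvd ihh, coeff_mul_of_X_pow_dvd ihb,
        coeff_mul_of_X_pow_dvd (hD b ihb), coeff_D, coeff_D, coeff_D, coeff_D, hak, map_zero,
        zero_add, hs, hfu, hac] at h3
      obtain ⟨h4, h5⟩ := eq_zero_of_solution hu (fun j hj => by
        rw [coeff_C_mul, hh k j hj, mul_zero]) h3
      have h6 : coeff k h = 0 := (mul_eq_zero.1 h4).resolve_left
        ((map_ne_zero_iff _ C_injective).2 hc)
      constructor <;> refine X_pow_dvd_iff.2 fun j hj => ?_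
      · rcases Nat.lt_succ_iff_lt_or_eq.1 hj with hj | rfl
        · exact X_pow_dvd_iff.1 ihh j hj
        · exact h6
      · rcases Nat.lt_succ_iff_lt_or_eq.1 hj with hj | rfl
        · exact X_pow_dvd_iff.1 ihb j hj
        · exact h5
  have hz : h = 0 := PowerSeries.ext fun k =>
    X_pow_dvd_iff.1 (key (k + 1)).1 k (Nat.lt_succ_self k)
  rw [hGF, hz, mul_zero, add_zero]

/-! ### Series with coefficients holomorphic on a fixed disc -/

/-- The norm `∑ |a_j| σ ^ j` of `∑ a_j t₂ ^ j`. -/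
noncomputable def nrmD (σ : ℝ≥0∞) : SerT2 → ℝ≥0∞ := wnorm (fun x : ℂ => ‖x‖ₑ) (σ ^ ·)

theorem nrmD_eq (σ : ℝ≥0∞) (x : SerT2) : nrmD σ x = ∑' j, ‖coeff j x‖ₑ * σ ^ j := rfl

theorem isSubmulNorm_nrmD (σ : ℝ≥0∞) : IsSubmulNorm (nrmD σ) :=
  isSubmulNorm_enorm.wnorm (pow_submul σ)

theorem nrmD_mono {σ τ : ℝ≥0∞} (h : σ ≤ τ) (x : SerT2) : nrmD σ x ≤ nrmD τ x :=
  ENNReal.tsum_le_tsum fun j => by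
    beta_reduce
    gcongr

theorem nrmD_C_ne_top (σ : ℝ≥0∞) (c : ℂ) : nrmD σ (C c) ≠ ∞ := by
  rw [nrmD_eq, tsum_eq_single 0]
  · simp
  · intro j hj
    simp [coeff_C, hj]

theorem nrmD_X_ne_top {σ : ℝ≥0∞} (h : σ ≠ ∞) : nrmD σ X ≠ ∞ := by
  rw [nrmD_eq, tsum_eq_single 1]
  · simpa [coeff_X] using h
  · intro j hj
    simp [coeff_X, hj]

/-- The power series in `t₂` which converge on the open disc of radius `ρ`. In contrast to the
finiteness of one norm, this condition is stable under differentiation. -/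
noncomputable def disc (ρ : ℝ≥0∞) : Subring SerT2 where
  carrier := {x | ∀ σ < ρ, nrmD σ x ≠ ∞}
  mul_mem' hx hy σ hσ := ne_top_of_le_ne_top (ENNReal.mul_ne_top (hx σ hσ) (hy σ hσ))
    ((isSubmulNorm_nrmD σ).mul_le _ _)
  one_mem' σ _ := by simpa using nrmD_C_ne_top σ 1
  add_mem' hx hy σ hσ := ne_top_of_le_ne_top (ENNReal.add_ne_top.2 ⟨hx σ hσ, hy σ hσ⟩)
    ((isSubmulNorm_nrmD σ).add_le _ _)
  zero_mem' σ _ := by simpa using nrmD_C_ne_top σ 0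
  neg_mem' {x} hx σ hσ := by
    have : nrmD σ (-x) = nrmD σ x := by simp [nrmD_eq]
    rw [this]
    exact hx σ hσ

theorem disc_anti {ρ ρ' : ℝ≥0∞} (h : ρ ≤ ρ') {x : SerT2} (hx : x ∈ disc ρ') : x ∈ disc ρ :=
  fun σ hσ => hx σ (hσ.trans_le h)

theorem C_mem_disc (ρ : ℝ≥0∞) (c : ℂ) : C c ∈ disc ρ := fun σ _ => nrmD_C_ne_top σ c

theorem X_mem_disc (ρ : ℝ≥0∞) : X ∈ disc ρ := fun _ hσ => nrmD_X_ne_top hσ.ne_top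

/-- A series whose coefficients are dominated by shifted coefficients of a series converging on a
disc converges on that disc. -/
theorem mem_disc_of_le {ρ : ℝ≥0∞} {x y : SerT2} (hx : x ∈ disc ρ) (m : ℕ)
    (h : ∀ j, ‖coeff j y‖ₑ ≤ ‖coeff (j + m) x‖ₑ) : y ∈ disc ρ := by
  intro σ hσ
  obtain ⟨τ, hστ, hτ⟩ := exists_between hσ
  have hτ0 : τ ≠ 0 := (zero_le.trans_lt hστ).ne'
  have hτt : τ ≠ ∞ := hτ.ne_top
  refine ne_top_of_le_ne_top ?_ (nrmD_mono hστ.le y)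
  have h1 : (τ ^ m)⁻¹ * nrmD τ x ≠ ∞ :=
    ENNReal.mul_ne_top (by simpa using pow_ne_zero m hτ0) (hx τ hτ)
  refine ne_top_of_le_ne_top h1 ?_
  calc nrmD τ y ≤ ∑' j, (τ ^ m)⁻¹ * (‖coeff (j + m) x‖ₑ * τ ^ (j + m)) := by
        refine ENNReal.tsum_le_tsum fun j => ?_
        calc ‖coeff j y‖ₑ * τ ^ j ≤ ‖coeff (j + m) x‖ₑ * τ ^ j := by gcongr; exact h j
          _ = ((τ ^ m)⁻¹ * τ ^ m) * (‖coeff (j + m) x‖ₑ * τ ^ j) := by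
            rw [ENNReal.inv_mul_cancel (pow_ne_zero m hτ0) (ENNReal.pow_ne_top hτt), one_mul]
          _ = _ := by rw [pow_add]; ring
    _ ≤ _ := by
      rw [ENNReal.tsum_mul_left]
      refine mul_le_mul_right ?_ _
      exact ENNReal.tsum_comp_le_tsum_of_injective (add_left_injective m)
        (fun j => ‖coeff j x‖ₑ * τ ^ j)

theorem der_mem_disc {ρ : ℝ≥0∞} (h1 : ρ ≤ 1) {x : SerT2} (hx : x ∈ disc ρ) : der x ∈ disc ρ := by
  intro σ hσ
  obtain ⟨τ, hστ, hτ⟩ := exists_between hσ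
  have hτ0 : τ ≠ 0 := (zero_le.trans_lt hστ).ne'
  have hτ1 : τ ≤ 1 := (hτ.trans_le h1).le
  have hτt : τ ≠ ∞ := hτ.ne_top
  -- Bernoulli's inequality bounds `(n + 1) σ ^ n` by a multiple of `τ ^ n`
  set s := τ - σ with hs
  have hs0 : s ≠ 0 := (tsub_pos_of_lt hστ).ne'
  have hs1 : s ≤ 1 := tsub_le_self.trans hτ1
  have hst : s ≠ ∞ := (hs1.trans_lt ENNReal.one_lt_top).ne
  have hle : σ * (1 + s) ≤ τ := by
    calc σ * (1 + s) = σ + σ * s := by ring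
      _ ≤ σ + 1 * s := by gcongr; exact hστ.le.trans hτ1
      _ = τ := by rw [one_mul, hs, add_tsub_cancel_of_le hστ.le]
  have hbern : ∀ n : ℕ, ((n : ℝ≥0∞) + 1) * σ ^ n ≤ (s⁻¹ * τ⁻¹) * τ ^ (n + 1) := fun n => by
    have h2 : s * ((n : ℝ≥0∞) + 1) ≤ (1 + s) ^ n :=
      calc s * ((n : ℝ≥0∞) + 1) = s + n * s := by ring
        _ ≤ 1 + n * s := by gcongr
        _ ≤ (1 + s) ^ n := one_add_mul_le_pow_of_sq_nonneg zero_le zero_le zero_le n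
    calc ((n : ℝ≥0∞) + 1) * σ ^ n = s⁻¹ * (s * ((n : ℝ≥0∞) + 1)) * σ ^ n := by
          rw [← mul_assoc, ENNReal.inv_mul_cancel hs0 hst, one_mul]
      _ ≤ s⁻¹ * (1 + s) ^ n * σ ^ n := by gcongr
      _ = s⁻¹ * (σ * (1 + s)) ^ n := by rw [mul_pow]; ring
      _ ≤ s⁻¹ * τ ^ n := by gcongr
      _ = s⁻¹ * (τ⁻¹ * τ) * τ ^ n := by rw [ENNReal.inv_mul_cancel hτ0 hτt, mul_one]
      _ = _ := by rw [pow_succ]; ring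
  have h2 : (s⁻¹ * τ⁻¹) * nrmD τ x ≠ ∞ :=
    ENNReal.mul_ne_top (ENNReal.mul_ne_top (by simpa using hs0) (by simpa using hτ0)) (hx τ hτ)
  refine ne_top_of_le_ne_top h2 ?_
  calc nrmD σ (der x) ≤ ∑' n, (s⁻¹ * τ⁻¹) * (‖coeff (n + 1) x‖ₑ * τ ^ (n + 1)) := by
        refine ENNReal.tsum_le_tsum fun n => ?_
        have hn : ‖(n : ℂ) + 1‖ₑ = (n : ℝ≥0∞) + 1 := by
          have : ((n : ℂ) + 1) = ((n + 1 : ℕ) : ℂ) := by simp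
          rw [this, ← ofReal_norm, Complex.norm_natCast, ENNReal.ofReal_natCast]
          simp
        beta_reduce
        rw [coeff_der, enorm_mul, hn, mul_assoc]
        calc _ ≤ ‖coeff (n + 1) x‖ₑ * ((s⁻¹ * τ⁻¹) * τ ^ (n + 1)) :=
              mul_le_mul' le_rfl (hbern n)
          _ = _ := by ring
    _ ≤ _ := by
      rw [ENNReal.tsum_mul_left]
      refine mul_le_mul_right ?_ _
      exact ENNReal.tsum_comp_le_tsum_of_injective (add_left_injective 1)
        (fun j => ‖coeff j x‖ₑ * τ ^ j)

/-- The diagonal operator `∑ a_n t₂ ^ n ↦ ∑ c_n a_n t₂ ^ n`. -/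
noncomputable def scale (c : ℕ → ℂ) : SerT2 →+ SerT2 where
  toFun x := PowerSeries.mk fun n => c n * coeff n x
  map_zero' := by ext; simp
  map_add' x y := by ext; simp [mul_add]

@[simp] theorem coeff_scale (c : ℕ → ℂ) (n : ℕ) (x : SerT2) :
    coeff n (scale c x) = c n * coeff n x := by simp [scale]

theorem scale_mem_disc {ρ : ℝ≥0∞} {c : ℕ → ℂ} (hc : ∀ n, ‖c n‖ ≤ 1) {x : SerT2}
    (hx : x ∈ disc ρ) : scale c x ∈ disc ρ := by
  refine mem_disc_of_le hx 0 fun j => ?_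
  rw [coeff_scale, add_zero, enorm_mul]
  have : ‖c j‖ₑ ≤ 1 := by
    rw [← ofReal_norm]
    exact ENNReal.ofReal_le_one.2 (hc j)
  exact mul_le_of_le_one_left' this

theorem norm_inv_natCast_le_one (n : ℕ) : ‖((n : ℂ))⁻¹‖ ≤ 1 := by
  rw [norm_inv, Complex.norm_natCast]
  exact Nat.cast_inv_le_one n

/-- The primitive in `t₂` without constant term. -/
noncomputable def prim : SerT2 →+ SerT2 :=
  (AddMonoidHom.mulLeft X).comp (scale fun n => ((n + 1 : ℕ) : ℂ)⁻¹)

theorem prim_apply (x : SerT2) : prim x = X * scale (fun n => ((n + 1 : ℕ) : ℂ)⁻¹) x := rfl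

theorem coeff_succ_prim (n : ℕ) (x : SerT2) :
    coeff (n + 1) (prim x) = ((n + 1 : ℕ) : ℂ)⁻¹ * coeff n x := by
  rw [prim_apply, coeff_succ_X_mul, coeff_scale]

theorem der_prim (x : SerT2) : der (prim x) = x := by
  ext n
  have : ((n + 1 : ℕ) : ℂ) ≠ 0 := Nat.cast_ne_zero.2 n.succ_ne_zero
  rw [coeff_der, coeff_succ_prim]
  push_cast at this ⊢
  field_simp

theorem prim_mem_disc {ρ : ℝ≥0∞} {x : SerT2} (hx : x ∈ disc ρ) : prim x ∈ disc ρ :=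
  (disc ρ).mul_mem (X_mem_disc ρ) (scale_mem_disc (fun _ => norm_inv_natCast_le_one _) hx)

/-- Division by `t₂ ^ m`, dropping the terms of order less than `m`. -/
noncomputable def shift (m : ℕ) : SerT2 →+ SerT2 where
  toFun x := PowerSeries.mk fun n => coeff (n + m) x
  map_zero' := by ext; simp
  map_add' x y := by ext; simp

@[simp] theorem coeff_shift (m n : ℕ) (x : SerT2) : coeff n (shift m x) = coeff (n + m) x := by
  simp [shift]

theorem shift_mem_disc {ρ : ℝ≥0∞} {x : SerT2} (hx : x ∈ disc ρ) (m : ℕ) : shift m x ∈ disc ρ :=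
  mem_disc_of_le hx m fun j => by rw [coeff_shift]

/-- The terms of order less than `m`. -/
noncomputable def low (m : ℕ) : SerT2 →+ SerT2 := scale fun n => if n < m then 1 else 0

theorem low_mem_disc {ρ : ℝ≥0∞} {x : SerT2} (hx : x ∈ disc ρ) (m : ℕ) : low m x ∈ disc ρ :=
  scale_mem_disc (fun n => by split_ifs <;> simp) hx

theorem low_add_shift (m : ℕ) (x : SerT2) : low m x + X ^ m * shift m x = x := by
  ext n
  rw [map_add, low, coeff_scale, coeff_X_pow_mul']
  by_cases h : n < m
  · simp [h, not_le.2 h]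
  · rw [if_neg h, if_pos (not_lt.1 h), coeff_shift, Nat.sub_add_cancel (not_lt.1 h)]
    ring

theorem low_eq_trunc (m : ℕ) (x : SerT2) : low m x = (trunc m x : Polynomial ℂ) := by
  ext n
  rw [low, coeff_scale, Polynomial.coeff_coe, coeff_trunc]
  split_ifs <;> simp

/-- The equation `2 t β' + r β = e`, divided by `t` if `r = 0`, has a solution operator preserving
convergence on discs. -/
theorem exists_euler_solver (r : ℕ) : ∃ B : SerT2 →+ SerT2,
    (∀ ρ, ∀ x ∈ disc ρ, B x ∈ disc ρ) ∧
    (r = 0 → ∀ x, 2 * der (B x) = x) ∧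
    (r ≠ 0 → ∀ x, 2 * (X * der (B x)) + (r : SerT2) * B x = x) := by
  rcases eq_or_ne r 0 with rfl | hr
  · refine ⟨(scale fun _ => 2⁻¹).comp prim, fun ρ x hx => ?_, fun _ x => ?_,
      fun h => absurd rfl h⟩
    · exact scale_mem_disc (fun _ => by simpa using norm_inv_natCast_le_one 2) (prim_mem_disc hx)
    · ext n
      have h1 : ((n + 1 : ℕ) : ℂ) ≠ 0 := Nat.cast_ne_zero.2 n.succ_ne_zero
      rw [← map_ofNat C 2, coeff_C_mul, coeff_der, AddMonoidHom.comp_apply, coeff_scale,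
        coeff_succ_prim]
      push_cast at h1 ⊢
      field_simp
  · refine ⟨scale fun n => ((2 * n + r : ℕ) : ℂ)⁻¹, fun ρ x hx =>
      scale_mem_disc (fun _ => norm_inv_natCast_le_one _) hx, fun h => absurd h hr, fun _ x => ?_⟩
    ext n
    have h1 : ((2 * n + r : ℕ) : ℂ) ≠ 0 := Nat.cast_ne_zero.2 (by omega)
    rw [map_add, ← map_ofNat C 2, ← map_natCast C r, coeff_C_mul, coeff_C_mul, coeff_X_mul_der,
      coeff_scale]
    push_cast at h1 ⊢
    field_simp

/-- The elements of `ℂ⟦t₂, z⟧` whose coefficients with respect to `z` converge on the disc of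
radius `ρ`. -/
noncomputable def discS (ρ : ℝ≥0∞) : Subring SerT2Z where
  carrier := {x | ∀ k, coeff k x ∈ disc ρ}
  mul_mem' hx hy k := by
    rw [coeff_mul]
    exact (disc ρ).sum_mem fun p _ => (disc ρ).mul_mem (hx _) (hy _)
  one_mem' k := by
    rw [coeff_one]
    split_ifs
    exacts [(disc ρ).one_mem, (disc ρ).zero_mem]
  add_mem' hx hy k := by
    rw [map_add]
    exact (disc ρ).add_mem (hx k) (hy k)
  zero_mem' k := by
    rw [map_zero]
    exact (disc ρ).zero_mem
  neg_mem' hx k := by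
    rw [map_neg]
    exact (disc ρ).neg_mem (hx k)

theorem C_mem_discS {ρ : ℝ≥0∞} {x : SerT2} (hx : x ∈ disc ρ) : C x ∈ discS ρ := fun k => by
  rw [coeff_C]
  split_ifs
  exacts [hx, (disc ρ).zero_mem]

theorem X_mem_discS (ρ : ℝ≥0∞) : X ∈ discS ρ := fun k => by
  rw [coeff_X]
  split_ifs
  exacts [(disc ρ).one_mem, (disc ρ).zero_mem]

theorem cw_mem_discS {ρ : ℝ≥0∞} {d : SerT2 →+ SerT2} (hd : ∀ x ∈ disc ρ, d x ∈ disc ρ)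
    {x : SerT2Z} (hx : x ∈ discS ρ) : cw d x ∈ discS ρ := fun k => by
  rw [coeff_cw]
  exact hd _ (hx k)

theorem D_mem_discS {ρ : ℝ≥0∞} (h1 : ρ ≤ 1) {x : SerT2Z} (hx : x ∈ discS ρ) : D x ∈ discS ρ :=
  cw_mem_discS (fun _ => der_mem_disc h1) hx

theorem nrmT_coeff_incl (σ : ℝ≥0∞) (x : SerT2Z) (k : ℕ) :
    nrmT σ (coeff k (incl x)) = nrmD σ (coeff k x) := by
  rw [nrmT, wnorm, tsum_eq_single 0]
  · rw [pow_zero, mul_one]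
    simp [incl, nrmD]
  · intro i hi
    simp [incl, coeff_C, hi, wnorm]

theorem incl_mem_formalSeries_of_mem_discS {ρ : ℝ≥0∞} (h0 : ρ ≠ 0) {x : SerT2Z}
    (hx : x ∈ discS ρ) : incl x ∈ formalSeries := by
  obtain ⟨σ, hσ0, hσ⟩ := exists_between (pos_iff_ne_zero.2 h0)
  have ht : σ ≠ ∞ := hσ.ne_top
  have hr : 0 < σ.toReal := ENNReal.toReal_pos hσ0.ne' ht
  refine ⟨_, hr, fun k => (summable_iff_nrmT_ne_top _ k hr).2 ?_⟩
  rw [ENNReal.ofReal_toReal ht, nrmT_coeff_incl]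
  exact hx k σ hσ

theorem exists_mem_discS {x : SerT2Z} (hx : incl x ∈ formalSeries) :
    ∃ ρ : ℝ≥0∞, ρ ≠ 0 ∧ x ∈ discS ρ := by
  obtain ⟨r, hr, h⟩ := hx
  refine ⟨ENNReal.ofReal r, by simpa using hr, fun k σ hσ => ?_⟩
  have h1 := (summable_iff_nrmT_ne_top _ k hr).1 (h k)
  rw [nrmT_coeff_incl] at h1
  exact ne_top_of_le_ne_top h1 (nrmD_mono hσ.le _)

/-! ### Existence of the formal normal form -/

/-- A unit `u` of `ℂ{t₂}` has an inverse, and `2 u s' = u' s` has a unit as a solution; `s` is a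
square root of `u` up to a constant. -/
theorem exists_sqrt {u : SerT2} (hu : constantCoeff u ≠ 0) {ρ : ℝ≥0∞} (hρ : ρ ≠ 0)
    (hud : u ∈ disc ρ) : ∃ (v s σ : SerT2) (τ : ℝ≥0∞), τ ≠ 0 ∧ τ ≤ ρ ∧ v ∈ disc τ ∧ s ∈ disc τ ∧
      σ ∈ disc τ ∧ u * v = 1 ∧ s * σ = 1 ∧ 2 * u * der s = der u * s := by
  have hW := isWeightClass_isWeight
  have mem : ∀ {x : SerT2Z}, x ∈ hW.ringS → ∃ τ : ℝ≥0∞, τ ≠ 0 ∧ x ∈ discS τ := fun {x} hx =>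
    exists_mem_discS (by rw [formalSeries_eq]; exact hx)
  have hu' : C u ∈ hW.ringS := by
    rw [hW.mem_ringS, ← formalSeries_eq]
    exact incl_mem_formalSeries_of_mem_discS hρ (C_mem_discS hud)
  have huv : u * u⁻¹ = 1 := PowerSeries.mul_inv_cancel u hu
  have hv : C u⁻¹ ∈ hW.ringS := hW.inv_mem hu' (by rw [← map_mul, huv, map_one])
  obtain ⟨Y, hY, hD, hY0⟩ := hW.exists_ode_D (ι := Unit)
    (fun _ _ => C (C 2⁻¹) * D (C u) * C u⁻¹)
    (fun _ _ => hW.ringS.mul_mem (hW.ringS.mul_mem (hW.const_mem _) (hW.D_mem hu')) hv)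
    (fun _ => 1)
  set s := constantCoeff (Y ()) with hs
  have hs0 : constantCoeff s ≠ 0 := by
    have h1 : constantCoeff s = 1 := hY0 ()
    rw [h1]
    exact one_ne_zero
  have hsm : C s ∈ hW.ringS := by
    have := hW.coeff_zero_mem (hY ())
    rwa [coeff_zero_eq_constantCoeff_apply] at this
  have hsσ : s * s⁻¹ = 1 := PowerSeries.mul_inv_cancel s hs0
  have hσ : C s⁻¹ ∈ hW.ringS := hW.inv_mem hsm (by rw [← map_mul, hsσ, map_one])
  have hode : der s = C 2⁻¹ * der u * u⁻¹ * s := by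
    have h1 := congrArg constantCoeff (hD ())
    rw [constantCoeff_D] at h1
    simpa [D_C] using h1
  obtain ⟨τ₁, h₁, m₁⟩ := mem hv
  obtain ⟨τ₂, h₂, m₂⟩ := mem hsm
  obtain ⟨τ₃, h₃, m₃⟩ := mem hσ
  have hC : ∀ {x : SerT2} {τ}, C x ∈ discS τ → x ∈ disc τ := fun {x τ} h => by
    simpa using h 0
  have hmin : ∀ {a b : ℝ≥0∞}, a ≠ 0 → b ≠ 0 → min a b ≠ 0 := fun {a b} ha hb => by
    rcases min_choice a b with h | h <;> rw [h] <;> assumption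
  refine ⟨u⁻¹, s, s⁻¹, min (min ρ τ₁) (min τ₂ τ₃), hmin (hmin hρ h₁) (hmin h₂ h₃),
    (min_le_left _ _).trans (min_le_left _ _),
    disc_anti ((min_le_left _ _).trans (min_le_right _ _)) (hC m₁),
    disc_anti ((min_le_right _ _).trans (min_le_left _ _)) (hC m₂),
    disc_anti ((min_le_right _ _).trans (min_le_right _ _)) (hC m₃), huv, hsσ, ?_⟩
  have h2 : (C 2⁻¹ : SerT2) * 2 = 1 := by
    rw [← map_ofNat C 2, ← map_mul]
    simp
  rw [hode]
  linear_combination (der u * s * (u * u⁻¹)) * h2 + der u * s * huv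

/-- On a sufficiently small disc, every series is the sum of its terms of order less than `r - 1`
and of an element of the image of `b ↦ 2 f₀ b' + f₀' b`, where `f₀` has order `r`; for `r ≤ 1`, the
operator is surjective, in accordance with the truncated subtraction. The substitution `b = β / √u`,
where `f₀ = t ^ r u`, turns it into the operator of `exists_euler_solver`, which is diagonal. -/
theorem exists_solver {f₀ : SerT2} {r : ℕ} (hr : f₀.order = r) {ρ : ℝ≥0∞} (hρ : ρ ≠ 0)
    (hf : f₀ ∈ disc ρ) : ∃ (τ : ℝ≥0∞) (B : SerT2 →+ SerT2), τ ≠ 0 ∧ τ ≤ ρ ∧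
      (∀ x ∈ disc τ, B x ∈ disc τ) ∧
      ∀ x, der f₀ * B x + 2 * f₀ * der (B x) = low (r - 1) x - x := by
  obtain ⟨u, hu, rfl⟩ := exists_eq_X_pow_mul hr
  have hud : u ∈ disc ρ := by
    have : u = shift r (X ^ r * u) := by
      ext n
      rw [coeff_shift, coeff_X_pow_mul]
    rw [this]
    exact shift_mem_disc hf r
  obtain ⟨v, s, σ, τ, hτ, hτρ, hv, hs, hσ, huv, hsσ, hode⟩ := exists_sqrt hu hρ hud
  obtain ⟨E, hE, hE0, hE1⟩ := exists_euler_solver r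
  -- `b = σ β`, where `β` is the solution for the right hand side `-v s (x / t ^ (r - 1))`
  let B : SerT2 →+ SerT2 := (AddMonoidHom.mulLeft σ).comp
    (E.comp ((AddMonoidHom.mulLeft (-(v * s))).comp (shift (r - 1))))
  have hB : ∀ x, B x = σ * E (-(v * s) * shift (r - 1) x) := fun x => rfl
  clear_value B
  have hders : der s * σ + s * der σ = 0 := by
    rw [← der_mul, hsσ, ← map_one C, der_C]
  -- the logarithmic derivative of `σ` is that of `u`, up to the factor `-1 / 2`
  have hσ' : 2 * u * der σ + der u * σ = 0 := by
    linear_combination -σ ^ 2 * hode + 2 * u * σ * hders - (2 * u * der σ + der u * σ) * hsσ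
  refine ⟨τ, B, hτ, hτρ, fun x hx => ?_, fun x => ?_⟩
  · rw [hB]
    exact (disc τ).mul_mem hσ (hE τ _ ((disc τ).mul_mem
      ((disc τ).neg_mem ((disc τ).mul_mem hv hs)) (shift_mem_disc hx _)))
  · have hlow : low (r - 1) x - x = -(X ^ (r - 1) * shift (r - 1) x) := by
      linear_combination low_add_shift (r - 1) x
    rw [hlow, hB, der_mul σ]
    set y := shift (r - 1) x
    rcases r with _ | r
    · have h1 := hE0 rfl (-(v * s) * y)
      set β := E (-(v * s) * y)
      simp only [pow_zero, one_mul, Nat.zero_sub]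
      linear_combination β * hσ' + u * σ * h1 - (s * σ * y) * huv - y * hsσ
    · have h1 := hE1 r.succ_ne_zero (-(v * s) * y)
      set β := E (-(v * s) * y)
      rw [der_X_pow_succ_mul, Nat.add_sub_cancel, pow_succ]
      linear_combination X ^ r * X * β * hσ' + X ^ r * u * σ * h1 - (X ^ r * s * σ * y) * huv -
        X ^ r * y * hsσ

/-- A map which is contracting for the `z`-adic topology has a fixed point, whose coefficients are
coefficients of iterates of the map. -/
theorem exists_fixed_point_adic {Φ : SerT2Z → SerT2Z}
    (hΦ : ∀ n x y, X ^ n ∣ x - y → X ^ (n + 1) ∣ Φ x - Φ y) {ρ : ℝ≥0∞}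
    (hmem : ∀ x ∈ discS ρ, Φ x ∈ discS ρ) : ∃ x ∈ discS ρ, x = Φ x := by
  let s : ℕ → SerT2Z := fun n => Φ^[n] 0
  have hs : ∀ n, s (n + 1) = Φ (s n) := fun n => Function.iterate_succ_apply' _ _ _
  have hsmem : ∀ n, s n ∈ discS ρ := fun n => by
    induction n with
    | zero => exact (discS ρ).zero_mem
    | succ n ih => rw [hs]; exact hmem _ ih
  have hstep : ∀ n, X ^ n ∣ s (n + 1) - s n := fun n => by
    induction n with
    | zero => simp
    | succ n ih =>
      have h1 := hΦ n _ _ ih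
      rwa [← hs, ← hs] at h1
  have hcauchy : ∀ m n, X ^ n ∣ s (n + m) - s n := fun m n => by
    induction m with
    | zero => simp
    | succ m ih =>
      have h1 : X ^ n ∣ s (n + m + 1) - s (n + m) :=
        (pow_dvd_pow X (Nat.le_add_right n m)).trans (hstep (n + m))
      have h2 := dvd_add h1 ih
      rwa [sub_add_sub_cancel] at h2
  let x : SerT2Z := PowerSeries.mk fun k => coeff k (s (k + 1))
  have hx : ∀ n, X ^ n ∣ x - s n := fun n => X_pow_dvd_iff.2 fun k hk => by
    obtain ⟨m, rfl⟩ : ∃ m, n = k + 1 + m := ⟨n - (k + 1), by omega⟩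
    have h1 := X_pow_dvd_iff.1 (hcauchy m (k + 1)) k (Nat.lt_succ_self k)
    rw [map_sub, sub_eq_zero] at h1 ⊢
    rw [h1, coeff_mk]
  refine ⟨x, fun k => by rw [coeff_mk]; exact hsmem _ k, ?_⟩
  ext1 k
  have h1 := hx (k + 1)
  have h2 := hΦ k _ _ (hx k)
  rw [← hs] at h2
  have h3 := X_pow_dvd_iff.1 (dvd_sub h1 h2) k (Nat.lt_succ_self k)
  rw [sub_sub_sub_cancel_right, map_sub, sub_eq_zero] at h3
  exact h3

theorem X_pow_dvd_cw {n : ℕ} {x : SerT2Z} (h : X ^ n ∣ x) (d : SerT2 →+ SerT2) :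
    X ^ n ∣ cw d x :=
  X_pow_dvd_iff.2 fun k hk => by rw [coeff_cw, X_pow_dvd_iff.1 h k hk, map_zero]

theorem X_pow_dvd_cw_sub {n : ℕ} {x y : SerT2Z} (h : X ^ n ∣ x - y) (d : SerT2 →+ SerT2) :
    X ^ n ∣ cw d x - cw d y := by
  rw [← map_sub]
  exact X_pow_dvd_cw h d

/-- Existence of the formal normal form. With `f = f₀ + z f₁` and `F = f₀ + z γ`, the equations of
`exists_quotient_of_gaugeIso` for `h = γ - f₁` and `a = 1 + z a₁` read
`γ - (2 f₀ b' + f₀' b) = R` with `R = f₁ + z (a₁'' + f₁' b + 2 f₁ b' - h a₁)`, where `γ`, `b` are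
obtained from `R` by the operators of `exists_solver`. Hence `R` is a fixed point of a map which is
contracting for the `z`-adic topology, all of whose iterates converge on the same disc. -/
theorem exists_isFormalNormalForm {f : SerT2Z} (hf : incl f ∈ formalSeries) {r : ℕ}
    (hr : (coeff 0 f).order = r) : ∃ F : SerT2Z, IsFormalNormalForm r F ∧
      coeff 0 F = coeff 0 f ∧ GaugeIso formalSeries (form f) (form F) := by
  obtain ⟨ρ, hρ, hfρ⟩ := exists_mem_discS hf
  obtain ⟨τ, B, hτ0, hτρ, hB, hsolve⟩ := exists_solver hr
    (ρ := min ρ 1) (by rcases min_choice ρ 1 with h | h <;> rw [h]; exacts [hρ, one_ne_zero])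
    (disc_anti (min_le_left _ _) (hfρ 0))
  have hτ1 : τ ≤ 1 := hτρ.trans (min_le_right _ _)
  set f₀ := coeff 0 f with hf₀
  obtain ⟨f₁, hf₁⟩ : X ∣ f - C f₀ := X_dvd_iff.2 (by simp [hf₀])
  have hff : f = C f₀ + X * f₁ := by rw [← hf₁]; ring
  have mf : f ∈ discS τ := fun k => disc_anti (hτρ.trans (min_le_left _ _)) (hfρ k)
  have mf₁ : f₁ ∈ discS τ := fun k => by
    have h1 := mf (k + 1)
    rwa [hff, map_add, coeff_C, if_neg k.succ_ne_zero, zero_add, coeff_succ_X_mul] at h1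
  let γ : SerT2Z →+ SerT2Z := cw (low (r - 1))
  let b : SerT2Z →+ SerT2Z := cw B
  let a₁ : SerT2Z → SerT2Z := fun R =>
    C (C 2⁻¹) * cw prim ((γ R - f₁) * b R - D (D (b R)))
  let Q : SerT2Z → SerT2Z := fun R =>
    D (D (a₁ R)) + D f₁ * b R + 2 * f₁ * D (b R) - (γ R - f₁) * a₁ R
  have mγ : ∀ R ∈ discS τ, γ R ∈ discS τ := fun R hR =>
    cw_mem_discS (fun x hx => low_mem_disc hx _) hR
  have mb : ∀ R ∈ discS τ, b R ∈ discS τ := fun R hR => cw_mem_discS hB hR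
  have ma₁ : ∀ R ∈ discS τ, a₁ R ∈ discS τ := fun R hR =>
    (discS τ).mul_mem (C_mem_discS (C_mem_disc _ _)) (cw_mem_discS (fun _ => prim_mem_disc)
      ((discS τ).sub_mem ((discS τ).mul_mem ((discS τ).sub_mem (mγ R hR) mf₁) (mb R hR))
        (D_mem_discS hτ1 (D_mem_discS hτ1 (mb R hR)))))
  have mQ : ∀ R ∈ discS τ, Q R ∈ discS τ := fun R hR =>
    (discS τ).sub_mem ((discS τ).add_mem ((discS τ).add_mem
      (D_mem_discS hτ1 (D_mem_discS hτ1 (ma₁ R hR)))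
      ((discS τ).mul_mem (D_mem_discS hτ1 mf₁) (mb R hR)))
      ((discS τ).mul_mem ((discS τ).mul_mem (natCast_mem (discS τ) 2) mf₁)
        (D_mem_discS hτ1 (mb R hR))))
      ((discS τ).mul_mem ((discS τ).sub_mem (mγ R hR) mf₁) (ma₁ R hR))
  have hQ : ∀ n R R', X ^ n ∣ R - R' → X ^ n ∣ Q R - Q R' := fun n R R' h => by
    have dγ : X ^ n ∣ (γ R - f₁) - (γ R' - f₁) := by
      rw [sub_sub_sub_cancel_right]
      exact X_pow_dvd_cw_sub h _
    have db : X ^ n ∣ b R - b R' := X_pow_dvd_cw_sub h _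
    have dDb : X ^ n ∣ D (b R) - D (b R') := X_pow_dvd_cw_sub db _
    have dDDb : X ^ n ∣ D (D (b R)) - D (D (b R')) := X_pow_dvd_cw_sub dDb _
    have da : X ^ n ∣ a₁ R - a₁ R' := by
      have h1 := dvd_sub (dvd_mul_sub_mul dγ db) dDDb
      have h2 : X ^ n ∣ ((γ R - f₁) * b R - D (D (b R))) - ((γ R' - f₁) * b R' - D (D (b R'))) := by
        convert h1 using 1
        ring
      have h3 := (X_pow_dvd_cw_sub h2 prim).mul_left (C (C 2⁻¹))
      rwa [mul_sub] at h3
    have dDDa : X ^ n ∣ D (D (a₁ R)) - D (D (a₁ R')) :=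
      X_pow_dvd_cw_sub (X_pow_dvd_cw_sub da _) _
    have h1 := dvd_sub (dvd_add (dvd_add dDDa (db.mul_left (D f₁))) (dDb.mul_left (2 * f₁)))
      (dvd_mul_sub_mul dγ da)
    convert h1 using 1
    simp only [Q]
    ring
  obtain ⟨R, mR, hR⟩ := exists_fixed_point_adic (Φ := fun R => f₁ + X * Q R) (ρ := τ)
    (fun n R R' h => by
      rw [add_sub_add_left_eq_sub, ← mul_sub, pow_succ']
      exact mul_dvd_mul_left X (hQ n R R' h))
    (fun R hR => (discS τ).add_mem mf₁ ((discS τ).mul_mem (X_mem_discS τ) (mQ R hR)))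
  have e1 : D (a₁ R) = C (C 2⁻¹) * ((γ R - f₁) * b R - D (D (b R))) := by
    simp only [a₁]
    rw [D_const_mul]
    congr 1
    ext1 k
    rw [coeff_D, coeff_cw, der_prim]
  have e2 : C (der f₀) * b R + 2 * C f₀ * D (b R) = γ R - R := by
    ext1 k
    have h1 := hsolve (coeff k R)
    have h2 : (2 * C f₀ : SerT2Z) = C (2 * f₀) := by rw [map_mul, map_ofNat]
    rw [h2, map_add, coeff_C_mul, coeff_C_mul, coeff_D, map_sub]
    simp only [b, γ, coeff_cw]
    exact h1
  have hR' : R = f₁ + X * (D (D (a₁ R)) + D f₁ * b R + 2 * f₁ * D (b R) - (γ R - f₁) * a₁ R) := hR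
  have hDf : D f = C (der f₀) + X * D f₁ := by rw [hff, map_add, D_C, D_X_mul]
  have c0 : coeff 0 (C f₀ + X * γ R) = f₀ := by simp
  have c1 : ∀ k, coeff (k + 1) (C f₀ + X * γ R) = low (r - 1) (coeff k R) := fun k => by
    rw [map_add, coeff_C, if_neg k.succ_ne_zero, zero_add, coeff_succ_X_mul, coeff_cw]
  refine ⟨C f₀ + X * γ R, ⟨?_, by rw [c0]; exact hr, fun hr1 => ?_, fun hr2 k hk => ?_⟩, c0, ?_⟩
  · exact incl_mem_formalSeries_of_mem_discS hτ0
      ((discS τ).add_mem (C_mem_discS (mf 0)) ((discS τ).mul_mem (X_mem_discS τ) (mγ R mR)))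
  · ext1 k
    rcases k with _ | k
    · simp
    · rw [c1, coeff_C, if_neg k.succ_ne_zero]
      ext n
      simp [low, Nat.sub_eq_zero_of_le hr1]
  · obtain ⟨k, rfl⟩ : ∃ m, k = m + 1 := ⟨k - 1, by omega⟩
    refine ⟨trunc (r - 1) (coeff k R), ?_, by rw [c1, low_eq_trunc]⟩
    have h1 := natDegree_trunc_lt (coeff k R) (r - 2)
    have h2 : r - 2 + 1 = r - 1 := by omega
    rw [h2] at h1
    omega
  · have hmem : ∀ {x}, x ∈ discS τ → x ∈ isWeightClass_isWeight.ringS := fun {x} hx => by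
      rw [isWeightClass_isWeight.mem_ringS, ← formalSeries_eq]
      exact incl_mem_formalSeries_of_mem_discS hτ0 hx
    rw [formalSeries_eq]
    have c2 := const_inv_two_mul_two
    have eD : D (1 + X * a₁ R) = X * D (a₁ R) := by rw [map_add, D_one, D_X_mul, zero_add]
    refine isWeightClass_isWeight.gaugeIso_form (a := 1 + X * a₁ R) (b := b R) (hmem mf)
      (hmem ((discS τ).add_mem (discS τ).one_mem
        ((discS τ).mul_mem (X_mem_discS τ) (ma₁ R mR)))) (hmem (mb R mR)) ?_ ?_ ?_
    · simp [orig]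
    · rw [eD]
      linear_combination 2 * X * e1 + X * ((γ R - f₁) * b R - D (D (b R))) * c2 + b R * hff
    · rw [eD, D_X_mul, D_mul f, hDf]
      linear_combination X * e2 - X * hR' + (2 * X * D (b R) + 1 + X * a₁ R) * hff

end TStr

theorem theorem5p1 :
    -- (i) holomorphic (T)-structures
    (∀ A : Fin 2 → TStr.Mat, TStr.IsTStructureN2 TStr.holomorphicSeries A →
      ∃ f : TStr.SerT2Z, TStr.incl f ∈ TStr.holomorphicSeries ∧
        TStr.IsTStructureN2 TStr.holomorphicSeries (TStr.form f) ∧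
        TStr.GaugeIso TStr.holomorphicSeries A (TStr.form f)) ∧
    -- (ii) formal (T)-structures
    (∀ A : Fin 2 → TStr.Mat, TStr.IsTStructureN2 TStr.formalSeries A →
      ∃ f : TStr.SerT2Z, TStr.incl f ∈ TStr.formalSeries ∧
        TStr.IsTStructureN2 TStr.formalSeries (TStr.form f) ∧
        TStr.GaugeIso TStr.formalSeries A (TStr.form f)) ∧
    -- (iii) formal gauge invariance of `f(0)`, and of `f(1)` if `f(0) = 0`
    (∀ f g : TStr.SerT2Z, TStr.incl f ∈ TStr.formalSeries → TStr.incl g ∈ TStr.formalSeries →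
      TStr.GaugeIso TStr.formalSeries (TStr.form f) (TStr.form g) →
        PowerSeries.coeff 0 f = PowerSeries.coeff 0 g ∧
        (PowerSeries.coeff 0 f = 0 → PowerSeries.coeff 1 f = PowerSeries.coeff 1 g)) ∧
    -- (iv) the holomorphic normal form `C₂ + z² f(1) E` if `f(0) = 0`
    (∀ f : TStr.SerT2Z, TStr.incl f ∈ TStr.holomorphicSeries → PowerSeries.coeff 0 f = 0 →
      TStr.GaugeIso TStr.holomorphicSeries (TStr.form f)
        (TStr.form (PowerSeries.X * PowerSeries.C (PowerSeries.coeff 1 f))) ∧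
      ∀ g : TStr.SerT2, TStr.incl (PowerSeries.C g) ∈ TStr.holomorphicSeries →
        TStr.GaugeIso TStr.holomorphicSeries (TStr.form f)
          (TStr.form (PowerSeries.X * PowerSeries.C g)) →
        g = PowerSeries.coeff 1 f) ∧
    -- (v) existence and uniqueness of the formal normal form if `f(0) ≠ 0`
    (∀ (r : ℕ) (f : TStr.SerT2Z), TStr.incl f ∈ TStr.formalSeries →
      (PowerSeries.coeff 0 f).order = r →
      (r ≤ 1 → TStr.GaugeIso TStr.formalSeries (TStr.form f)
        (TStr.form (PowerSeries.C (PowerSeries.coeff 0 f)))) ∧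
      ∃ F : TStr.SerT2Z, TStr.IsFormalNormalForm r F ∧
        PowerSeries.coeff 0 F = PowerSeries.coeff 0 f ∧
        TStr.GaugeIso TStr.formalSeries (TStr.form f) (TStr.form F) ∧
        ∀ (s : ℕ) (G : TStr.SerT2Z), TStr.IsFormalNormalForm s G →
          TStr.GaugeIso TStr.formalSeries (TStr.form f) (TStr.form G) → G = F) ∧
    -- (v) the formal normal form is a formal gauge invariant
    (∀ f g : TStr.SerT2Z, TStr.incl f ∈ TStr.formalSeries → TStr.incl g ∈ TStr.formalSeries →
      TStr.GaugeIso TStr.formalSeries (TStr.form f) (TStr.form g) →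
      ∀ (r s : ℕ) (F G : TStr.SerT2Z),
        TStr.IsFormalNormalForm r F → TStr.IsFormalNormalForm s G →
        TStr.GaugeIso TStr.formalSeries (TStr.form f) (TStr.form F) →
        TStr.GaugeIso TStr.formalSeries (TStr.form g) (TStr.form G) → F = G) := by
  have hH := TStr.isWeightClass_geomWeights
  have hF := TStr.isWeightClass_isWeight
  refine ⟨fun A hA => ?_, fun A hA => ?_, fun f g _ _ h => ?_, fun f hf h0 => ⟨?_, fun g _ h => ?_⟩,
    fun r f hf hr => ?_, fun f g _ _ h r s F G hFn hGn h1 h2 => ?_⟩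
  · rw [TStr.holomorphicSeries_eq] at hA ⊢
    obtain ⟨f, hf, h⟩ := hH.exists_gaugeIso_form hA
    exact ⟨f, hf, hH.isTStructureN2_form hf, h⟩
  · rw [TStr.formalSeries_eq] at hA ⊢
    obtain ⟨f, hf, h⟩ := hF.exists_gaugeIso_form hA
    exact ⟨f, hf, hF.isTStructureN2_form hf, h⟩
  · exact ⟨TStr.coeff_zero_eq_of_gaugeIso h, TStr.coeff_one_eq_of_gaugeIso h⟩
  · rw [TStr.holomorphicSeries_eq] at hf ⊢
    exact hH.gaugeIso_of_coeff_zero_eq_zero hf h0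
  · rw [TStr.coeff_one_eq_of_gaugeIso h h0, ← zero_add 1, PowerSeries.coeff_succ_X_mul]
    simp
  · obtain ⟨F, hFn, hF0, h⟩ := TStr.exists_isFormalNormalForm hf hr
    refine ⟨fun hr1 => ?_, F, hFn, hF0, h, fun s G hGn h' => ?_⟩
    · rwa [hFn.low hr1, hF0] at h
    · rw [TStr.formalSeries_eq] at h h'
      exact hGn.eq_of_gaugeIso hFn (hF.gaugeIso_trans (hF.gaugeIso_symm h') h)
  · rw [TStr.formalSeries_eq] at h h1 h2
    exact hFn.eq_of_gaugeIso hGn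
      (hF.gaugeIso_trans (hF.gaugeIso_symm h1) (hF.gaugeIso_trans h h2))
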